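/- Let $\mathcal H$ be a complex Hilbert space and $A:D(A)\subset\mathcal H\to\mathcal H$ a self-adjoint operator with form domain $\mathcal F(A)=D(|A|^{1/2})$; for $x\in\mathcal F(A)$ write $(x,Ax)$ for the value at $x$ of the quadratic form of $A$. Let $\mathcal H_+,\mathcal H_-$ be two orthogonal closed subspaces of $\mathcal H$ with $\mathcal H=\mathcal H_+\oplus\mathcal H_-$, and let $\Lambda_\pm$ be the orthogonal projectors onto $\mathcal H_\pm$. Let $F$ be a subspace of $D(A)$ which is dense in $D(A)$ for the graph norm (a core of $A$), and assume: (i) $F_+=\Lambda_+F$ and $F_-=\Lambda_-F$ are subspaces of $\mathcal F(A)$; (ii) $a_-:=\sup_{x\in F_-\setminus\{0\}}\frac{(x,Ax)}{\|x\|^2}<+\infty$. For integers $k\ge 1$ define the min-max levels $$c_k(A)=\inf_{\substack{V\text{ subspace of }F_+\\ \dim V=k}}\ \sup_{x\in (V\oplus F_-)\setminus\{0\}}\frac{(x,Ax)}{\|x\|^2}\ ,$$ and assume moreover (iii) $c_1(A)>a_-$. (Infima and suprema are taken in $[-\infty,+\infty]$, with $\inf\emptyset=+\infty$ and $\sup\emptyset=-\infty$.)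 Let $\sigma_{\rm ess}(A)$ be the essential spectrum of $A$, that is, the set of all points of the spectrum which are not isolated eigenvalues of finite multiplicity, and let $b=\inf\big(\sigma_{\rm ess}(A)\cap(a_-,+\infty)\big)$. Then $b\in(a_-,+\infty]$ and $$c_k(A)=\mu_k\qquad\text{for all }k\ge 1,$$ where $\mu_k$ denotes the $k$-th eigenvalue of $A$ (in increasing order, counted with multiplicity) in the interval $(a_-,b)$ if it exists, and $\mu_k=b$ if there is no $k$-th eigenvalue. As a consequence, $b=\lim_{k\to\infty}c_k(A)=\sup_{k\ge1}c_k(A)>a_-$. -/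

import Mathlib

open Filter Topology
open scoped InnerProductSpace

namespace GapMinMax

noncomputable section

variable {H : Type*} [NormedAddCommGroup H] [InnerProductSpace ℂ H] [CompleteSpace H]

/-! ### Form domain and quadratic form of a self-adjoint operator -/

/-- The (closed) graph of `A`, as a subspace of the Hilbert space `H ⊕ H`. -/
def hilbertGraph (A : H →ₗ.[ℂ] H) : Submodule ℂ (WithLp 2 (H × H)) :=
  (A.graph.map (WithLp.linearEquiv 2 ℂ (H × H)).symm.toLinearMap).topologicalClosure

instance instCompleteSpaceHilbertGraph (A : H →ₗ.[ℂ] H) : CompleteSpace (hilbertGraph A) := by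
  unfold hilbertGraph; infer_instance

/-- The bounded operator `(1 + A²)⁻¹` of a self-adjoint operator `A`: its value at `x` is the first
component of the orthogonal projection of `(x, 0)` onto the graph of `A`.
See `invOneAddSq_spec`. -/
def invOneAddSq (A : H →ₗ.[ℂ] H) : H →L[ℂ] H :=
  WithLp.fstL 2 ℂ H H ∘L (hilbertGraph A).starProjection ∘L
    ((WithLp.prodContinuousLinearEquiv 2 ℂ H H).symm : H × H →L[ℂ] WithLp 2 (H × H)) ∘L
      ContinuousLinearMap.inl ℂ H H

/-- The bounded operator `(1 + A²)^(-1/2)`. -/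
def invSqrt (A : H →ₗ.[ℂ] H) : H →L[ℂ] H := CFC.sqrt (invOneAddSq A)

/-- The bounded operator `(1 + A²)^(-1/4)`. -/
def invFourthRoot (A : H →ₗ.[ℂ] H) : H →L[ℂ] H := CFC.sqrt (invSqrt A)

/-- The form domain of `A`, i.e. the domain of `|A|^(1/2)`, which is the domain of `(1 + A²)^(1/4)`,
in other words the range of `(1 + A²)^(-1/4)`. -/
def formDomain (A : H →ₗ.[ℂ] H) : Submodule ℂ H := LinearMap.range (invFourthRoot A).toLinearMap

open scoped Classical in
/-- `A` as a function on all of `H`, extended by `0` outside its domain. -/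
def totalFun (A : H →ₗ.[ℂ] H) (x : H) : H := if h : x ∈ A.domain then A ⟨x, h⟩ else 0

/-- The quadratic form `(x, A x)` of the self-adjoint operator `A` at a point `x` of its form
domain (it is only used there). Writing `x = (1 + A²)^(-1/4) ξ` it is `(ξ, A (1 + A²)^(-1/2) ξ)`,
where `A (1 + A²)^(-1/2)` is everywhere defined and bounded (see `range_invSqrt`).
On the domain of `A` it is `(x, A x)`, see `quadForm_eq_inner`. -/
def quadForm (A : H →ₗ.[ℂ] H) (x : H) : ℝ :=
  (⟪Function.invFun (invFourthRoot A) x,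
    totalFun A (invSqrt A (Function.invFun (invFourthRoot A) x))⟫_ℂ).re

/-! ### Spectrum, essential spectrum, eigenvalues -/

/-- The spectrum of a closed operator: all `z` for which `A - z` is not a bijection of the domain
onto the space. -/
def opSpectrum (A : H →ₗ.[ℂ] H) : Set ℂ :=
  {z | ¬ Function.Bijective fun x : A.domain => A x - z • (x : H)}

/-- The eigenspace `ker (A - t)`. -/
def eigenspace (A : H →ₗ.[ℂ] H) (t : ℝ) : Submodule ℂ H :=
  (LinearMap.ker (A.toFun - (t : ℂ) • A.domain.subtype)).map A.domain.subtype

/-- The essential spectrum of a self-adjoint operator: the points of its (real) spectrum which are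
not isolated points of the spectrum that are eigenvalues of finite multiplicity. -/
def essentialSpectrum (A : H →ₗ.[ℂ] H) : Set ℝ :=
  {t | (t : ℂ) ∈ opSpectrum A ∧
    ¬ (¬ AccPt (t : ℂ) (𝓟 (opSpectrum A)) ∧ eigenspace A t ≠ ⊥ ∧
      FiniteDimensional ℂ (eigenspace A t))}

/-- The infimum (`+∞` for the empty set) of the part of the essential spectrum above `a`. -/
def essentialBottomAbove (A : H →ₗ.[ℂ] H) (a : EReal) : EReal :=
  sInf {s | ∃ t ∈ essentialSpectrum A, a < (t : EReal) ∧ s = (t : EReal)}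

/-- `t` is the `k`-th eigenvalue, in increasing order and counted with multiplicity, of `A` in the
interval `(a, b)`: fewer than `k` eigenvalues lie in `(a, t)` and at least `k` in `(a, t]`.
Eigenspaces being independent, the number of eigenvalues is the dimension of the span of the
eigenspaces. -/
def IsKthEigenvalue (A : H →ₗ.[ℂ] H) (a b : EReal) (k : ℕ) (t : ℝ) : Prop :=
  a < (t : EReal) ∧ (t : EReal) < b ∧
    Module.rank ℂ (⨆ s ∈ {s : ℝ | a < (s : EReal) ∧ s < t}, eigenspace A s : Submodule ℂ H) < k ∧
    k ≤ Module.rank ℂ (⨆ s ∈ {s : ℝ | a < (s : EReal) ∧ s ≤ t}, eigenspace A s : Submodule ℂ H)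

/-- `m` is the `k`-th eigenvalue of `A` in `(a, b)` if it exists, and `b` otherwise. -/
def IsKthLevel (A : H →ₗ.[ℂ] H) (a b : EReal) (k : ℕ) (m : EReal) : Prop :=
  (∃ t : ℝ, IsKthEigenvalue A a b k t ∧ m = (t : EReal)) ∨
    ((¬ ∃ t : ℝ, IsKthEigenvalue A a b k t) ∧ m = b)

/-! ### Rayleigh quotients and min-max levels -/

/-- The supremum of `(x, A x) / ‖x‖²` over the nonzero vectors of a subspace of the form domain
(`-∞` for the zero subspace). -/
def supRayleigh (A : H →ₗ.[ℂ] H) (W : Submodule ℂ H) : EReal :=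
  ⨆ x ∈ {x : H | x ∈ W ∧ x ≠ 0}, ((quadForm A x / ‖x‖ ^ 2 : ℝ) : EReal)

/-- The `k`-th min-max level for `k ≥ 1` (`+∞` if there is no `k`-dimensional subspace of `Fp`). -/
def minMaxLevel (A : H →ₗ.[ℂ] H) (Fp Fm : Submodule ℂ H) (k : ℕ) : EReal :=
  ⨅ V ∈ {V : Submodule ℂ H | V ≤ Fp ∧ Module.finrank ℂ V = k}, supRayleigh A (V ⊔ Fm)

/-! ### Consistency facts for the definitions above -/

theorem hilbertGraph_eq {A : H →ₗ.[ℂ] H} (hA : IsSelfAdjoint A) (p : WithLp 2 (H × H)) :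
    p ∈ hilbertGraph A ↔ ∃ y : A.domain, p = WithLp.toLp 2 ((y : H), A y) := by
  have hc : IsClosed ((A.graph.map (WithLp.linearEquiv 2 ℂ (H × H)).symm.toLinearMap :
      Submodule ℂ (WithLp 2 (H × H))) : Set (WithLp 2 (H × H))) := by
    have h1 : IsClosed (A.graph : Set (H × H)) := hA.isClosed
    rw [Submodule.map_coe, LinearEquiv.coe_coe, LinearEquiv.image_symm_eq_preimage]
    exact h1.preimage (WithLp.prod_continuous_ofLp _ _ _)
  rw [hilbertGraph, hc.submodule_topologicalClosure_eq]
  constructor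
  · rintro ⟨q, hq, rfl⟩
    obtain ⟨y, hy1, hy2⟩ := (LinearPMap.mem_graph_iff _).1 hq
    exact ⟨y, by rw [hy1, hy2]; rfl⟩
  · rintro ⟨y, rfl⟩
    exact ⟨((y : H), A y), LinearPMap.mem_graph _ y, rfl⟩

/-- The operator `S = invOneAddSq A` satisfies `S x ∈ D(A)`, `A S x ∈ D(A)` and `S x + A A S x = x`;
moreover `⟨S x, z⟩ + ⟨A S x, A z⟩ = ⟨x, z⟩` for all `z` in the domain. -/
theorem invOneAddSq_spec {A : H →ₗ.[ℂ] H} (hA : IsSelfAdjoint A) (x : H) :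
    ∃ y w : A.domain, (y : H) = invOneAddSq A x ∧ (w : H) = A y ∧ (y : H) + A w = x := by
  set u : WithLp 2 (H × H) := WithLp.toLp 2 (x, 0) with hu
  obtain ⟨y, hy⟩ := (hilbertGraph_eq hA _).1
    ((hilbertGraph A).starProjection_apply_mem u)
  have horth := (hilbertGraph A).sub_starProjection_mem_orthogonal u
  have key : ∀ z : A.domain, ⟪x - (y : H), (z : H)⟫_ℂ = ⟪A y, A z⟫_ℂ := by
    intro z
    have := Submodule.inner_left_of_mem_orthogonal ((hilbertGraph_eq hA _).2 ⟨z, rfl⟩) horth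
    rw [hy] at this
    simp only [hu, WithLp.prod_inner_apply, WithLp.ofLp_sub, Prod.fst_sub, Prod.snd_sub,
      zero_sub, inner_neg_left] at this
    exact add_neg_eq_zero.1 this
  have hmem := LinearPMap.mem_adjoint_domain_of_exists (T := A) (A y) ⟨_, key⟩
  have happ := LinearPMap.adjoint_apply_eq hA.dense_domain ⟨_, hmem⟩ key
  have hAA : LinearPMap.adjoint A = A := hA
  have hmem' : A y ∈ A.domain := by rw [hAA] at hmem; exact hmem
  refine ⟨y, ⟨A y, hmem'⟩, ?_, rfl, ?_⟩
  · have : invOneAddSq A x = ((hilbertGraph A).starProjection u).fst := rfl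
    rw [this, hy]
    rfl
  · have : A ⟨A y, hmem'⟩ = LinearPMap.adjoint A ⟨_, hmem⟩ := by
      refine (LinearPMap.dExt_iff.1 hAA).2 (x := ⟨_, hmem⟩) (y := ⟨A y, hmem'⟩) rfl |>.symm
    rw [this, happ]
    abel

theorem domain_inner_symm {A : H →ₗ.[ℂ] H} (hA : IsSelfAdjoint A) (x y : A.domain) :
    ⟪A x, (y : H)⟫_ℂ = ⟪(x : H), A y⟫_ℂ := by
  have hAA : LinearPMap.adjoint A = A := hA
  have := LinearPMap.adjoint_isFormalAdjoint hA.dense_domain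
  rw [hAA] at this
  exact this x y

theorem eq_invOneAddSq {A : H →ₗ.[ℂ] H} (hA : IsSelfAdjoint A) {x : H} (y w : A.domain)
    (hw : (w : H) = A y) (h : (y : H) + A w = x) : (y : H) = invOneAddSq A x := by
  obtain ⟨y', w', hy', hw', h'⟩ := invOneAddSq_spec hA x
  rw [← hy', ← sub_eq_zero]
  have h1 : A (y - y') = ((w - w' : A.domain) : H) := by
    rw [A.map_sub, ← hw, ← hw']; rfl
  have h2 : ((y - y' : A.domain) : H) + A (w - w') = 0 := by
    rw [A.map_sub, Submodule.coe_sub, ← sub_eq_zero.2 (h.trans h'.symm)]; abel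
  have h3 := domain_inner_symm hA (y - y') (w - w')
  have h4 := congrArg (fun v => ⟪((y - y' : A.domain) : H), v⟫_ℂ) h2
  simp only [inner_add_right, inner_zero_right] at h4
  rw [← h3, h1, inner_self_eq_norm_sq_to_K, inner_self_eq_norm_sq_to_K] at h4
  have h5 : ‖(((y - y' : A.domain)) : H)‖ ^ 2 + ‖((w - w' : A.domain) : H)‖ ^ 2 = 0 := by
    have := congrArg Complex.re h4
    simpa [← Complex.ofReal_pow] using this
  have h6 : ‖((y - y' : A.domain) : H)‖ ^ 2 = 0 :=
    le_antisymm (by linarith [sq_nonneg (‖((w - w' : A.domain) : H)‖)]) (sq_nonneg _)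
  exact norm_eq_zero.1 (pow_eq_zero_iff two_ne_zero |>.1 h6)

theorem invOneAddSq_nonneg {A : H →ₗ.[ℂ] H} (hA : IsSelfAdjoint A) : 0 ≤ invOneAddSq A := by
  have key : ∀ x x' : H, ∃ y y' : A.domain, (y : H) = invOneAddSq A x ∧
      (y' : H) = invOneAddSq A x' ∧
      ⟪invOneAddSq A x, x'⟫_ℂ = ⟪(y : H), (y' : H)⟫_ℂ + ⟪A y, A y'⟫_ℂ ∧
      ⟪x, invOneAddSq A x'⟫_ℂ = ⟪(y : H), (y' : H)⟫_ℂ + ⟪A y, A y'⟫_ℂ ∧ (x = x' → y = y') := by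
    intro x x'
    obtain ⟨y, w, hy, hw, h⟩ := invOneAddSq_spec hA x
    obtain ⟨y', w', hy', hw', h'⟩ := invOneAddSq_spec hA x'
    refine ⟨y, y', hy, hy', ?_, ?_, ?_⟩
    · rw [← hy, ← h', inner_add_right, ← domain_inner_symm hA, hw']
    · rw [← hy', ← h, inner_add_left, domain_inner_symm hA, hw]
    · rintro rfl
      exact Subtype.ext (hy.trans hy'.symm)
  rw [ContinuousLinearMap.nonneg_iff_isPositive]
  refine ⟨fun x x' => ?_, fun x => ?_⟩
  · obtain ⟨y, y', -, -, h1, h2, -⟩ := key x x'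
    exact h1.trans h2.symm
  · obtain ⟨y, y', -, -, h1, -, h3⟩ := key x x
    obtain rfl := h3 rfl
    rw [ContinuousLinearMap.reApplyInnerSelf_apply, h1, map_add]
    exact add_nonneg inner_self_nonneg inner_self_nonneg

theorem invOneAddSq_injective {A : H →ₗ.[ℂ] H} (hA : IsSelfAdjoint A) :
    Function.Injective (invOneAddSq A) := by
  refine (injective_iff_map_eq_zero _).2 fun x hx => ?_
  obtain ⟨y, w, hy, hw, h⟩ := invOneAddSq_spec hA x
  have hy0 : y = 0 := Subtype.ext (hy.trans hx)
  subst hy0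
  have hw0 : w = 0 := Subtype.ext (by rw [hw, A.map_zero]; rfl)
  rw [← h, hw0, A.map_zero]
  simp

theorem invSqrt_mul_self {A : H →ₗ.[ℂ] H} (hA : IsSelfAdjoint A) :
    invSqrt A * invSqrt A = invOneAddSq A :=
  CFC.sqrt_mul_sqrt_self _ (invOneAddSq_nonneg hA)

theorem invFourthRoot_mul_self (A : H →ₗ.[ℂ] H) :
    invFourthRoot A * invFourthRoot A = invSqrt A :=
  CFC.sqrt_mul_sqrt_self _ (CFC.sqrt_nonneg _)

theorem invFourthRoot_injective {A : H →ₗ.[ℂ] H} (hA : IsSelfAdjoint A) :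
    Function.Injective (invFourthRoot A) := by
  refine (injective_iff_map_eq_zero _).2 fun x hx => ?_
  apply (injective_iff_map_eq_zero _).1 (invOneAddSq_injective hA)
  rw [← invSqrt_mul_self hA, ← invFourthRoot_mul_self]
  simp [hx]

theorem invSqrt_inner (A : H →ₗ.[ℂ] H) (x y : H) : ⟪invSqrt A x, y⟫_ℂ = ⟪x, invSqrt A y⟫_ℂ :=
  ((ContinuousLinearMap.nonneg_iff_isPositive _).1 (CFC.sqrt_nonneg (invOneAddSq A))).isSymmetric x y

theorem invFourthRoot_inner (A : H →ₗ.[ℂ] H) (x y : H) :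
    ⟪invFourthRoot A x, y⟫_ℂ = ⟪x, invFourthRoot A y⟫_ℂ :=
  ((ContinuousLinearMap.nonneg_iff_isPositive _).1 (CFC.sqrt_nonneg (invSqrt A))).isSymmetric x y

/-- `S = (1 + A²)⁻¹` commutes with `A` on the domain of `A`. -/
theorem invOneAddSq_comm {A : H →ₗ.[ℂ] H} (hA : IsSelfAdjoint A) (z : A.domain) :
    ∃ y w : A.domain, (y : H) = invOneAddSq A z ∧ (w : H) = A y ∧ (y : H) + A w = z ∧
      A y = invOneAddSq A (A z) := by
  obtain ⟨y, w, hy, hw, h⟩ := invOneAddSq_spec hA (z : H)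
  refine ⟨y, w, hy, hw, h, ?_⟩
  have h1 : ((z - y : A.domain) : H) = A w := by
    rw [Submodule.coe_sub, ← h]; abel
  rw [← hw]
  refine eq_invOneAddSq hA w (z - y) h1 ?_
  rw [A.map_sub, hw]; abel

theorem norm_invSqrt_apply_le {A : H →ₗ.[ℂ] H} (hA : IsSelfAdjoint A) (z : A.domain) :
    ‖invSqrt A (A z)‖ ≤ ‖(z : H)‖ := by
  obtain ⟨y, w, hy, hw, h, hc⟩ := invOneAddSq_comm hA z
  have h1 : ⟪invSqrt A (A z), invSqrt A (A z)⟫_ℂ = ⟪(z : H), (z : H)⟫_ℂ - ⟪(y : H), (z : H)⟫_ℂ := by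
    have h0 : invSqrt A (invSqrt A (A z)) = invOneAddSq A (A z) := by
      rw [← invSqrt_mul_self hA]; rfl
    rw [← invSqrt_inner, h0, ← hc, ← hw,
      ← domain_inner_symm hA, ← inner_sub_left]
    rw [eq_sub_of_add_eq' h]
  have h2 : 0 ≤ (⟪(y : H), (z : H)⟫_ℂ).re := by
    rw [hy]
    exact ((ContinuousLinearMap.nonneg_iff_isPositive _).1
      (invOneAddSq_nonneg hA)).re_inner_nonneg_left _
  have h3 : ‖invSqrt A (A z)‖ ^ 2 = ‖(z : H)‖ ^ 2 - (⟪(y : H), (z : H)⟫_ℂ).re := by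
    have := congrArg Complex.re h1
    rw [Complex.sub_re] at this
    rw [← inner_self_eq_norm_sq (𝕜 := ℂ), ← inner_self_eq_norm_sq (𝕜 := ℂ)]
    exact this
  refine abs_le_of_sq_le_sq' ?_ (norm_nonneg _) |>.2
  linarith

/-- The bounded operator `Z = A (1 + A²)^(-1/2)`. -/
theorem exists_boundedTransform {A : H →ₗ.[ℂ] H} (hA : IsSelfAdjoint A) :
    ∃ Z : H →L[ℂ] H, (∀ x, ∃ y : A.domain, (y : H) = invSqrt A x ∧ A y = Z x) ∧
      Commute (invOneAddSq A) Z := by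
  have hAA : LinearPMap.adjoint A = A := hA
  have hmem : ∀ x, invSqrt A x ∈ A.domain := by
    intro x
    suffices h : invSqrt A x ∈ (LinearPMap.adjoint A).domain by rwa [hAA] at h
    rw [LinearPMap.mem_adjoint_domain_iff]
    refine AddMonoidHomClass.continuous_of_bound ((innerₛₗ ℂ (invSqrt A x)).comp A.toFun) ‖x‖
      fun z => ?_
    calc ‖⟪invSqrt A x, A z⟫_ℂ‖ = ‖⟪x, invSqrt A (A z)⟫_ℂ‖ := by rw [invSqrt_inner]
      _ ≤ ‖x‖ * ‖invSqrt A (A z)‖ := norm_inner_le_norm _ _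
      _ ≤ ‖x‖ * ‖z‖ := by gcongr; exact norm_invSqrt_apply_le hA z
  let Z₀ : H →ₗ[ℂ] H := A.toFun ∘ₗ (invSqrt A).toLinearMap.codRestrict A.domain hmem
  have hZ₀ : ∀ x, Z₀ x = A ⟨invSqrt A x, hmem x⟩ := fun x => rfl
  have hb : ∀ x, ‖Z₀ x‖ ≤ 1 * ‖x‖ := by
    intro x
    rw [one_mul]
    have hcl : ∀ u : H, ‖⟪Z₀ x, u⟫_ℂ‖ ≤ ‖x‖ * ‖u‖ := by
      intro u
      refine hA.dense_domain.induction (P := fun u => ‖⟪Z₀ x, u⟫_ℂ‖ ≤ ‖x‖ * ‖u‖) ?_ ?_ u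
      · intro z hz
        calc ‖⟪Z₀ x, z⟫_ℂ‖ = ‖⟪invSqrt A x, A ⟨z, hz⟩⟫_ℂ‖ := by
              rw [hZ₀]; exact congrArg _ (domain_inner_symm hA ⟨invSqrt A x, hmem x⟩ ⟨z, hz⟩)
          _ = ‖⟪x, invSqrt A (A ⟨z, hz⟩)⟫_ℂ‖ := by rw [invSqrt_inner]
          _ ≤ ‖x‖ * ‖invSqrt A (A ⟨z, hz⟩)‖ := norm_inner_le_norm _ _
          _ ≤ ‖x‖ * ‖z‖ := by gcongr; exact norm_invSqrt_apply_le hA ⟨z, hz⟩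
      · exact isClosed_le (by fun_prop) (by fun_prop)
    have h := hcl (Z₀ x)
    rw [inner_self_eq_norm_sq_to_K] at h
    simp only [norm_pow, RCLike.norm_ofReal, abs_norm] at h
    by_contra! hlt
    nlinarith [norm_nonneg x, norm_nonneg (Z₀ x)]
  refine ⟨Z₀.mkContinuous 1 hb, fun x => ⟨⟨_, hmem x⟩, rfl, rfl⟩, ?_⟩
  ext x
  change invOneAddSq A (Z₀ x) = Z₀ (invOneAddSq A x)
  obtain ⟨y, w, hy, -, -, hc⟩ := invOneAddSq_comm hA ⟨invSqrt A x, hmem x⟩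
  rw [hZ₀, hZ₀, ← hc]
  congr 1
  refine Subtype.ext ?_
  change (y : H) = invSqrt A (invOneAddSq A x)
  rw [hy, ← invSqrt_mul_self hA]
  rfl

theorem range_invSqrt {A : H →ₗ.[ℂ] H} (hA : IsSelfAdjoint A) :
    LinearMap.range (invSqrt A).toLinearMap = A.domain := by
  obtain ⟨Z, hZ, hcomm⟩ := exists_boundedTransform hA
  have hcs : Commute (invSqrt A) Z := by
    rw [invSqrt, CFC.sqrt_eq_cfc]
    exact hcomm.cfc_nnreal _
  refine le_antisymm ?_ fun z hz => ?_
  · rintro _ ⟨x, rfl⟩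
    obtain ⟨y, hy, -⟩ := hZ x
    exact hy ▸ y.2
  · refine ⟨invSqrt A z + Z (A ⟨z, hz⟩), ?_⟩
    obtain ⟨y, w, hy, hw, h, hc⟩ := invOneAddSq_comm hA ⟨z, hz⟩
    have h1 : invSqrt A (invSqrt A z) = y := by rw [hy, ← invSqrt_mul_self hA]; rfl
    have h2 : invSqrt A (Z (A ⟨z, hz⟩)) = A w := by
      have : invSqrt A (Z (A ⟨z, hz⟩)) = Z (invSqrt A (A ⟨z, hz⟩)) :=
        DFunLike.congr_fun hcs.eq (A ⟨z, hz⟩)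
      rw [this]
      obtain ⟨v, hv, hv'⟩ := hZ (invSqrt A (A ⟨z, hz⟩))
      rw [← hv']
      congr 1
      refine Subtype.ext ?_
      rw [hv, hw, hc, ← invSqrt_mul_self hA]
      rfl
    change invSqrt A (invSqrt A z + Z (A ⟨z, hz⟩)) = z
    rw [map_add, h1, h2, h]

theorem domain_le_formDomain {A : H →ₗ.[ℂ] H} (hA : IsSelfAdjoint A) :
    A.domain ≤ formDomain A := by
  rw [← range_invSqrt hA, ← invFourthRoot_mul_self]
  rintro _ ⟨x, rfl⟩
  exact ⟨invFourthRoot A x, rfl⟩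

/-- On the domain of `A` the quadratic form is `(x, A x)`. -/
theorem quadForm_eq_inner {A : H →ₗ.[ℂ] H} (hA : IsSelfAdjoint A) (z : A.domain) :
    quadForm A z = (⟪(z : H), A z⟫_ℂ).re := by
  obtain ⟨Z, hZ, hcomm⟩ := exists_boundedTransform hA
  have hcs : Commute (invSqrt A) Z := by
    rw [invSqrt, CFC.sqrt_eq_cfc]
    exact hcomm.cfc_nnreal _
  have hcf : Commute (invFourthRoot A) Z := by
    rw [invFourthRoot, CFC.sqrt_eq_cfc]
    exact hcs.cfc_nnreal _
  have hz : (z : H) ∈ LinearMap.range (invSqrt A).toLinearMap := by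
    rw [range_invSqrt hA]; exact z.2
  obtain ⟨e, he⟩ := hz
  replace he : invSqrt A e = z := he
  have h1 : invFourthRoot A (invFourthRoot A e) = z := by
    rw [← he, ← invFourthRoot_mul_self]; rfl
  have h2 : Function.invFun (invFourthRoot A) (z : H) = invFourthRoot A e := by
    rw [← h1]
    exact Function.leftInverse_invFun (invFourthRoot_injective hA) _
  have h3 : ∀ x, totalFun A (invSqrt A x) = Z x := by
    intro x
    obtain ⟨y, hy, hy'⟩ := hZ x
    rw [← hy, ← hy', totalFun, dif_pos y.2]
  have h4 : A z = Z e := by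
    rw [← h3, he, totalFun, dif_pos z.2]
  have h5 : Z (invFourthRoot A e) = invFourthRoot A (Z e) :=
    (DFunLike.congr_fun hcf.eq e).symm
  rw [quadForm, h2, h3, h5, ← invFourthRoot_inner, h1, h4]

end

end GapMinMax

/-! Fix a real `l` with a_- < l < c_1 and let q be the quadratic form of A - l. On F_- one has q(y)
≤ -d‖y‖², while every u in F_+ can be corrected by some y in F_- so that q(u + y) ≥ e‖u + y‖².
Playing these two bounds against each other on the core gives ‖x‖ ≤ C‖(A - l)x‖
(`GapSplitting.norm_le`). Hence (a_-, c_1) contains no spectrum and R = (A - l)⁻¹ is bounded and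
self-adjoint. The spectral subspace of A for (l, m) is, up to closure, the range of (R - r)₊ with r
= 1/(m - l), and the theorem reduces to comparing the rank of (R - r)₊ with the levels c_k.

Upper bound on c_k (`exists_trial_subspace`): if f = Rg and z = f + y' with y' in F_-, then q(z) = 2
Re(g, z) - q(f) + q(y') with q(y') ≤ 0. When t·q(f) = t(g, Rg) ≥ ‖g‖², completing the square gives
q(z) ≤ t‖z‖². Vectors g close to the spectral subspace satisfy this, and the F_+ components of the
Rg form the trial space.

Lower bound on c_k (`rank_le`): if V has level at most l + t, lift u in V to h = u + y with y nearly
maximising the form of A - l - t over u + F_-. Expanding q(tx - h + y') ≥ 0 for x = Rh and a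
suitable y' in F_-, near-stationarity of h makes the terms linear in y' almost cancel, leaving
2t‖h‖² ≤ t²(h, Rh) + q(h) up to a small error. Since q(h) ≤ t‖h‖², the quotient (h, Rh)/‖h‖² is
nearly at least 1/t, so (R - r)₊ is injective on the lifts as soon as rt < 1.

Maximisers over F_- need not exist, since F_- need not be complete for the form; near-maximisers
suffice. Likewise inequalities are proved for x in F in a form that is closed in (x, Ax), and then
extended to D(A).

Finally b is the threshold at which the rank of (R - r)₊ becomes infinite; below it the range is
spanned by eigenvectors, and counting them identifies c_k (`isKthLevel_of_rank`). -/

namespace GapMinMax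

noncomputable section

variable {H : Type*} [NormedAddCommGroup H] [InnerProductSpace ℂ H] [CompleteSpace H]

/-! ### The part of a bounded self-adjoint operator above a level -/

/-- The positive part `(R - r)₊` of a bounded self-adjoint operator. -/
def excess (R : H →L[ℂ] H) (r : ℝ) : H →L[ℂ] H := cfc (fun x : ℝ => max (x - r) 0) R

theorem algebraMap_real_apply {E : Type*} [NormedAddCommGroup E] [InnerProductSpace ℂ E]
    (r : ℝ) (x : E) : (algebraMap ℝ (E →L[ℂ] E) r) x = (r : ℂ) • x := by
  rw [Algebra.algebraMap_eq_smul_one]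
  rfl

theorem cfc_sub_const_mul {R : H →L[ℂ] H} (hR : IsSelfAdjoint R) (r : ℝ) {f : ℝ → ℝ}
    (hf : Continuous f) (x : H) :
    cfc (fun y : ℝ => (y - r) * f y) R x = R (cfc f R x) - (r : ℂ) • cfc f R x := by
  rw [cfc_mul (fun y : ℝ => y - r) f R, cfc_sub (fun y : ℝ => y) (fun _ => r) R, cfc_id' ℝ R,
    cfc_const r R]
  change R (cfc f R x) - (algebraMap ℝ (H →L[ℂ] H) r) (cfc f R x) = _
  rw [algebraMap_real_apply]

theorem cfc_mul_sub_const {R : H →L[ℂ] H} (hR : IsSelfAdjoint R) (r : ℝ) {f : ℝ → ℝ}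
    (hf : Continuous f) (x : H) :
    cfc (fun y : ℝ => (y - r) * f y) R x = cfc f R (R x - (r : ℂ) • x) := by
  have : (fun y : ℝ => (y - r) * f y) = fun y => f y * (y - r) := by ext; ring
  rw [this, cfc_mul f (fun y : ℝ => y - r) R, cfc_sub (fun y : ℝ => y) (fun _ => r) R, cfc_id' ℝ R,
    cfc_const r R]
  change cfc f R (R x - (algebraMap ℝ (H →L[ℂ] H) r) x) = _
  rw [algebraMap_real_apply]

theorem excess_symm (R : H →L[ℂ] H) (r : ℝ) (x y : H) :
    ⟪excess R r x, y⟫_ℂ = ⟪x, excess R r y⟫_ℂ :=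
  (cfc_predicate (fun x : ℝ => max (x - r) 0) R :
    IsSelfAdjoint (excess R r)).isSymmetric x y

theorem excess_re_inner_nonneg (R : H →L[ℂ] H) (r : ℝ) (x : H) :
    0 ≤ (⟪x, excess R r x⟫_ℂ).re := by
  have h : 0 ≤ excess R r := cfc_nonneg fun x _ => le_max_right _ _
  exact ((ContinuousLinearMap.nonneg_iff_isPositive _).1 h).re_inner_nonneg_right x

/-- Functional calculus applied to (y - r)(y - r)₊ = ((y - r)₊)². -/
theorem sub_excess {R : H →L[ℂ] H} (hR : IsSelfAdjoint R) (r : ℝ) (x : H) :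
    R (excess R r x) - (r : ℂ) • excess R r x = excess R r (excess R r x) := by
  rw [excess, ← cfc_sub_const_mul hR r (by fun_prop)]
  have : (fun y : ℝ => (y - r) * max (y - r) 0) = fun y => max (y - r) 0 * max (y - r) 0 := by
    ext y
    rcases le_total (y - r) 0 with h | h
    · simp [h]
    · simp [h]
  rw [this, cfc_mul (fun y : ℝ => max (y - r) 0) (fun y : ℝ => max (y - r) 0) R]
  rfl

theorem excess_comm {R : H →L[ℂ] H} (hR : IsSelfAdjoint R) (r : ℝ) (x : H) :
    R (excess R r x) = excess R r (R x) := by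
  have h1 := cfc_sub_const_mul hR 0 (f := fun x : ℝ => max (x - r) 0) (by fun_prop) x
  have h2 := cfc_mul_sub_const hR 0 (f := fun x : ℝ => max (x - r) 0) (by fun_prop) x
  rw [h1] at h2
  simpa [excess] using h2

theorem excess_excess_eq_zero (R : H →L[ℂ] H) (r : ℝ) {x : H}
    (h : excess R r (excess R r x) = 0) : excess R r x = 0 := by
  rw [← inner_self_eq_zero (𝕜 := ℂ), excess_symm, h, inner_zero_right]

theorem re_inner_of_mem_range_excess {R : H →L[ℂ] H} (hR : IsSelfAdjoint R) {r : ℝ} {h : H}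
    (hh : h ∈ LinearMap.range (excess R r).toLinearMap) :
    r * ‖h‖ ^ 2 ≤ (⟪h, R h⟫_ℂ).re := by
  obtain ⟨x, rfl⟩ := hh
  have h1 := sub_excess hR r x
  have h2 := excess_re_inner_nonneg R r (excess R r x)
  rw [← h1, inner_sub_right, inner_smul_right, inner_self_eq_norm_sq_to_K, Complex.sub_re] at h2
  have : ((r : ℂ) * ((‖excess R r x‖ : ℝ) : ℂ) ^ 2).re = r * ‖excess R r x‖ ^ 2 := by
    rw [← Complex.ofReal_pow, ← Complex.ofReal_mul, Complex.ofReal_re]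
  change r * ‖excess R r x‖ ^ 2 ≤ (⟪excess R r x, R (excess R r x)⟫_ℂ).re
  simp only [Complex.coe_algebraMap] at h2
  linarith

/-- On the kernel of (R - r)₊ the operator r - R coincides with (r - R)₊, which is nonnegative. -/
theorem re_inner_of_excess_eq_zero {R : H →L[ℂ] H} (hR : IsSelfAdjoint R) {r : ℝ} {h : H}
    (hh : excess R r h = 0) : (⟪h, R h⟫_ℂ).re ≤ r * ‖h‖ ^ 2 := by
  have h0 : 0 ≤ cfc (fun x : ℝ => max (r - x) 0) R := cfc_nonneg fun x _ => le_max_right _ _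
  have h1 := ((ContinuousLinearMap.nonneg_iff_isPositive _).1 h0).re_inner_nonneg_right h
  have h2 : cfc (fun x : ℝ => max (r - x) 0) R =
      cfc (fun x : ℝ => max (x - r) 0) R - cfc (fun x : ℝ => (x - r) * 1) R := by
    rw [← cfc_sub (fun x : ℝ => max (x - r) 0) (fun x : ℝ => (x - r) * 1) R]
    congr 1
    ext x
    rcases le_total x r with h | h
    · simp [h]
    · simp [h]
  have h3 : cfc (fun x : ℝ => max (r - x) 0) R h = (r : ℂ) • h - R h := by
    have h4 := cfc_sub_const_mul hR r (f := fun _ => 1) continuous_const h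
    have h5 : cfc (fun _ : ℝ => (1 : ℝ)) R = 1 := cfc_const_one ℝ R
    rw [h5] at h4
    rw [h2]
    change excess R r h - cfc (fun x : ℝ => (x - r) * 1) R h = _
    rw [hh, h4]
    simp
  rw [h3, inner_sub_right, inner_smul_right, inner_self_eq_norm_sq_to_K] at h1
  have : ((r : ℂ) * ((‖h‖ : ℝ) : ℂ) ^ 2).re = r * ‖h‖ ^ 2 := by
    rw [← Complex.ofReal_pow, ← Complex.ofReal_mul, Complex.ofReal_re]
  simp only [map_sub, RCLike.re_to_complex, Complex.coe_algebraMap] at h1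
  linarith

/-- For `r < ρ` the identity `1 = (R - ρ) g(R) + (ρ - r)⁻¹ (R - r)₊`. -/
theorem exists_parametrix {R : H →L[ℂ] H} (hR : IsSelfAdjoint R) {r ρ : ℝ} (hr : r < ρ) :
    ∃ G : H →L[ℂ] H, ∀ x : H,
      x = (R (G x) - (ρ : ℂ) • G x) + ((ρ - r : ℝ) : ℂ)⁻¹ • excess R r x ∧
      x = G (R x - (ρ : ℂ) • x) + ((ρ - r : ℝ) : ℂ)⁻¹ • excess R r x := by
  have hpos : ∀ x : ℝ, 0 < max (ρ - x) (ρ - r) := fun x => lt_max_of_lt_right (by linarith)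
  -- Minus the reciprocal of ρ - x, with ρ - x cut off from below at ρ - r: the exact inverse of x -
  -- ρ for x ≤ r, while for x ≥ r the defect is exactly (x - r)/(ρ - r).
  set g : ℝ → ℝ := fun x => - (max (ρ - x) (ρ - r))⁻¹ with hg
  have hgc : Continuous g :=
    (Continuous.inv₀ (by fun_prop) fun x => (hpos x).ne').neg
  have h1 : cfc (fun x : ℝ => (x - ρ) * g x) R + (ρ - r)⁻¹ • excess R r = 1 := by
    rw [excess, ← cfc_smul (ρ - r)⁻¹ (fun x : ℝ => max (x - r) 0) R,
      ← cfc_add R (fun x : ℝ => (x - ρ) * g x) _, ← cfc_const_one ℝ R]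
    congr 1
    ext x
    simp only [hg, smul_eq_mul]
    have h0 : ρ - r ≠ 0 := by linarith
    rcases le_total x r with h | h
    · rw [max_eq_left (by linarith), max_eq_right (by linarith)]
      have : ρ - x ≠ 0 := by linarith
      field_simp
      ring
    · rw [max_eq_right (by linarith), max_eq_left (by linarith)]
      field_simp
      ring
  refine ⟨cfc g R, fun x => ?_⟩
  have h2 := congrArg (fun T : H →L[ℂ] H => T x) h1
  simp only [add_apply, one_apply_eq_self] at h2
  have h3 : ((ρ - r)⁻¹ • excess R r) x = ((ρ - r : ℝ) : ℂ)⁻¹ • excess R r x := by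
    rw [← Complex.ofReal_inv]; rfl
  rw [h3] at h2
  constructor
  · rw [← cfc_sub_const_mul hR ρ hgc, h2]
  · rw [← cfc_mul_sub_const hR ρ hgc, h2]

theorem mem_range_excess_of_eigenvector {R : H →L[ℂ] H} (hR : IsSelfAdjoint R) {r ρ : ℝ}
    (hr : r < ρ) {h : H} (hh : R h = (ρ : ℂ) • h) :
    h ∈ LinearMap.range (excess R r).toLinearMap := by
  obtain ⟨G, hG⟩ := exists_parametrix hR hr
  have := (hG h).2
  rw [hh, sub_self, map_zero, zero_add] at this
  rw [this]
  exact Submodule.smul_mem _ _ ⟨h, rfl⟩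

theorem mapsTo_range_excess {R : H →L[ℂ] H} (hR : IsSelfAdjoint R) (r : ℝ) :
    ∀ h ∈ LinearMap.range (excess R r).toLinearMap,
      R.toLinearMap h ∈ LinearMap.range (excess R r).toLinearMap := by
  rintro _ ⟨x, rfl⟩
  exact ⟨R x, (excess_comm hR r x).symm⟩

/-- The parametrix solves (R - ρ)h = z up to an error in the range of (R - r)₊; this range is
invariant and finite-dimensional, so injectivity of R - ρ there corrects the error. -/
theorem bijective_sub_of_finiteDimensional {R : H →L[ℂ] H} (hR : IsSelfAdjoint R) {r ρ : ℝ}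
    (hr : r < ρ) [FiniteDimensional ℂ (LinearMap.range (excess R r).toLinearMap)]
    (hinj : ∀ h : H, R h = (ρ : ℂ) • h → h = 0) :
    Function.Bijective fun h : H => R h - (ρ : ℂ) • h := by
  set E := LinearMap.range (excess R r).toLinearMap with hE
  let T : H →ₗ[ℂ] H := R.toLinearMap - (ρ : ℂ) • LinearMap.id
  have hT : ∀ h, T h = R h - (ρ : ℂ) • h := fun h => rfl
  have hTE : ∀ h ∈ E, T h ∈ E := fun h hh =>
    E.sub_mem (mapsTo_range_excess hR r h hh) (E.smul_mem _ hh)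
  have hTinj : Function.Injective T := by
    refine (injective_iff_map_eq_zero _).2 fun h hh => hinj h ?_
    exact sub_eq_zero.1 hh
  refine ⟨hTinj, fun z => ?_⟩
  have hsurj : Function.Surjective (T.restrict hTE) := by
    rw [← LinearMap.injective_iff_surjective]
    intro x y hxy
    exact Subtype.ext (hTinj (congrArg Subtype.val hxy))
  obtain ⟨G, hG⟩ := exists_parametrix hR hr
  obtain ⟨w, hw⟩ := hsurj ⟨excess R r z, z, rfl⟩
  have hw' : T w = excess R r z := congrArg Subtype.val hw
  refine ⟨G z + ((ρ - r : ℝ) : ℂ)⁻¹ • (w : H), ?_⟩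
  change T (G z + _) = z
  rw [map_add, map_smul, hw', hT]
  exact ((hG z).1).symm

/-- If `(R - r)₊` has finite rank, its range is spanned by eigenvectors of `R` for eigenvalues
greater than `r`. -/
theorem range_excess_le_iSup {R : H →L[ℂ] H} (hR : IsSelfAdjoint R) (r : ℝ)
    [FiniteDimensional ℂ (LinearMap.range (excess R r).toLinearMap)] :
    LinearMap.range (excess R r).toLinearMap ≤
      ⨆ ρ ∈ Set.Ioi r, Module.End.eigenspace R.toLinearMap (ρ : ℂ) := by
  set E := LinearMap.range (excess R r).toLinearMap with hE
  have hS : (R.toLinearMap.restrict (mapsTo_range_excess hR r)).IsSymmetric := fun x y =>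
    hR.isSymmetric (x : H) y
  have htop := Submodule.orthogonal_eq_bot_iff.1 hS.orthogonalComplement_iSup_eigenspaces_eq_bot
  have h1 : E = (⊤ : Submodule ℂ E).map E.subtype := by simp
  rw [h1, ← htop, Submodule.map_iSup]
  refine iSup_le fun μ => ?_
  rintro _ ⟨x, hx, rfl⟩
  by_cases hx0 : x = 0
  · simp [hx0]
  have hxμ := Module.End.mem_eigenspace_iff.1 hx
  have hev : Module.End.HasEigenvalue (R.toLinearMap.restrict (mapsTo_range_excess hR r)) μ :=
    Module.End.hasEigenvalue_of_hasEigenvector ⟨hx, hx0⟩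
  have hreal : (μ.re : ℂ) = μ := Complex.conj_eq_iff_re.1 (hS.conj_eigenvalue_eq_self hev)
  have hRx : R (x : H) = (μ.re : ℂ) • (x : H) := by
    rw [hreal]; exact congrArg Subtype.val hxμ
  obtain ⟨ξ, hξ⟩ := x.2
  replace hξ : excess R r ξ = x := hξ
  have h2 := sub_excess hR r ξ
  rw [hξ, hRx, ← sub_smul, ← Complex.ofReal_sub] at h2
  have hne : (x : H) ≠ 0 := fun h => hx0 (Subtype.ext h)
  -- On x the operator (R - r)₊ acts as μ - r, which must be nonnegative; μ = r would give (R - r)₊²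
  -- ξ = 0 and hence x = 0.
  have h3 : r < μ.re := by
    by_contra! hle
    have h4 := excess_re_inner_nonneg R r (x : H)
    rw [← h2, inner_smul_right, inner_self_eq_norm_sq_to_K]  at h4
    simp only [Complex.coe_algebraMap] at h4
    rw [← Complex.ofReal_pow, ← Complex.ofReal_mul, Complex.ofReal_re] at h4
    have h5 : 0 < ‖(x : H)‖ ^ 2 := by positivity
    have h6 : μ.re - r = 0 := by nlinarith
    rw [h6, Complex.ofReal_zero, zero_smul, ← hξ] at h2
    exact hne (hξ ▸ excess_excess_eq_zero R r h2.symm)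
  refine Submodule.mem_iSup_of_mem μ.re (Submodule.mem_iSup_of_mem h3 ?_)
  exact Module.End.mem_eigenspace_iff.2 hRx

theorem finite_eigenvalues_of_finiteDimensional {R : H →L[ℂ] H} (hR : IsSelfAdjoint R) (r : ℝ)
    [FiniteDimensional ℂ (LinearMap.range (excess R r).toLinearMap)] :
    {ρ : ℝ | r < ρ ∧ Module.End.eigenspace R.toLinearMap (ρ : ℂ) ≠ ⊥}.Finite := by
  have h1 := Module.End.finite_hasEigenvalue (R.toLinearMap.restrict (mapsTo_range_excess hR r))
  refine (h1.preimage Complex.ofReal_injective.injOn).subset ?_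
  rintro ρ ⟨hρ, hne⟩
  obtain ⟨h, hh, h0⟩ := Submodule.exists_mem_ne_zero_of_ne_bot hne
  have hh' : R h = (ρ : ℂ) • h := Module.End.mem_eigenspace_iff.1 hh
  refine Module.End.hasEigenvalue_of_hasEigenvector
    (x := ⟨h, mem_range_excess_of_eigenvector hR hρ hh'⟩) ⟨?_, fun h => h0 (congrArg Subtype.val h)⟩
  exact Module.End.mem_eigenspace_iff.2 (Subtype.ext hh')

/-- Since r < s, the quotient (x - s)₊ / (x - r)₊ extends to a continuous function, so (R - s)₊
factors through (R - r)₊. -/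
theorem range_excess_anti (R : H →L[ℂ] H) {r s : ℝ} (hrs : r < s) :
    LinearMap.range (excess R s).toLinearMap ≤ LinearMap.range (excess R r).toLinearMap := by
  obtain ⟨c, hc, hcs⟩ : ∃ c : ℝ → ℝ, Continuous c ∧
      ∀ x, max (x - s) 0 = max (x - r) 0 * c x := by
    have hpos : ∀ x : ℝ, 0 < max (x - r) (s - r) := fun x => lt_max_of_lt_right (by linarith)
    refine ⟨fun x => max (x - s) 0 * (max (x - r) (s - r))⁻¹,
      Continuous.mul (by fun_prop) (Continuous.inv₀ (by fun_prop) fun x => (hpos x).ne'),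
      fun x => ?_⟩
    rcases le_total x s with h | h
    · simp [h]
    · have h1 : x - r ≠ 0 := by linarith
      simp only
      rw [max_eq_left (by linarith : (0 : ℝ) ≤ x - r),
        max_eq_left (by linarith : s - r ≤ x - r)]
      field_simp
  have h1 : excess R s = excess R r * cfc c R := by
    rw [excess, excess, ← cfc_mul (fun x : ℝ => max (x - r) 0) c R]
    congr 1
    exact funext hcs
  rintro _ ⟨x, rfl⟩
  exact ⟨cfc c R x, by rw [h1]; rfl⟩

theorem excess_eq_zero_of_norm_le {R : H →L[ℂ] H} {r : ℝ} (hr : ‖R‖ ≤ r) :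
    excess R r = 0 := by
  by_cases hH : Nontrivial H
  · rw [excess, ← cfc_const_zero ℝ R]
    refine cfc_congr fun x hx => ?_
    have := spectrum.norm_le_norm_of_mem hx
    have h2 := le_abs_self x
    rw [Real.norm_eq_abs] at this
    exact max_eq_right (by linarith)
  · rw [not_nontrivial_iff_subsingleton] at hH
    ext x
    exact Subsingleton.elim _ _

/-- An isolated point `ρ` with finite-dimensional eigenspace can be crossed without losing the
finite rank of `(R - r)₊`. -/
theorem finiteDimensional_range_excess_of_isolated {R : H →L[ℂ] H} (hR : IsSelfAdjoint R)
    {ρ ε ε' : ℝ} (hε' : 0 < ε') (hεε : ε' < ε)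
    (hiso : ∀ x ∈ spectrum ℝ R, |x - ρ| < ε → x = ρ)
    (heig : FiniteDimensional ℂ (Module.End.eigenspace R.toLinearMap (ρ : ℂ)))
    (hfin : FiniteDimensional ℂ (LinearMap.range (excess R (ρ + ε')).toLinearMap)) :
    FiniteDimensional ℂ (LinearMap.range (excess R (ρ - ε')).toLinearMap) := by
  have hpos : ∀ x : ℝ, 0 < max (x - ρ - ε') (ε - ε') :=
    fun x => lt_max_of_lt_right (by linarith)
  -- Chosen so that (y - ρ)(y - ρ + ε')₊ = c(y)(y - ρ - ε')₊ on the spectrum: at y = ρ both sides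
  -- vanish, and every other spectral point is at distance at least ε > ε' from ρ. Thus R - ρ maps
  -- the range for ρ - ε' into a finite-dimensional space, with kernel inside the eigenspace.
  set c : ℝ → ℝ := fun x => (x - ρ) * (x - ρ + ε') * (max (x - ρ - ε') (ε - ε'))⁻¹ with hc
  have hcc : Continuous c :=
    Continuous.mul (by fun_prop) (Continuous.inv₀ (by fun_prop) fun x => (hpos x).ne')
  have h1 : ∀ x : H, R (excess R (ρ - ε') x) - (ρ : ℂ) • excess R (ρ - ε') x =
      cfc c R (excess R (ρ + ε') x) := by
    intro x
    rw [excess, ← cfc_sub_const_mul hR ρ (by fun_prop)]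
    have h2 : cfc (fun y : ℝ => (y - ρ) * max (y - (ρ - ε')) 0) R =
        cfc (fun y : ℝ => c y * max (y - (ρ + ε')) 0) R := by
      refine cfc_congr fun y hy => ?_
      simp only [hc]
      rcases lt_or_ge |y - ρ| ε with h | h
      · obtain rfl := hiso y hy h
        simp
      · rcases le_abs.1 h with h | h
        · rw [max_eq_left (by linarith), max_eq_left (by linarith), max_eq_left (by linarith)]
          have : y - ρ - ε' ≠ 0 := by linarith
          have h3 : y - (ρ + ε') = y - ρ - ε' := by ring
          rw [h3]
          field_simp
          ring
        · rw [max_eq_right (by linarith : y - (ρ - ε') ≤ 0),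
            max_eq_right (by linarith : y - (ρ + ε') ≤ 0)]
          simp
    have h3 : Continuous fun y : ℝ => max (y - (ρ + ε')) 0 := by fun_prop
    rw [h2, cfc_mul c _ R hcc.continuousOn h3.continuousOn]
    rfl
  let T : LinearMap.range (excess R (ρ - ε')).toLinearMap →ₗ[ℂ] H :=
    (R.toLinearMap - (ρ : ℂ) • LinearMap.id) ∘ₗ Submodule.subtype _
  have hTr : LinearMap.range T ≤
      (LinearMap.range (excess R (ρ + ε')).toLinearMap).map (cfc c R).toLinearMap := by
    rintro _ ⟨⟨_, x, rfl⟩, rfl⟩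
    exact ⟨excess R (ρ + ε') x, ⟨x, rfl⟩, (h1 x).symm⟩
  have hTk : (LinearMap.ker T).map (Submodule.subtype _) ≤
      Module.End.eigenspace R.toLinearMap (ρ : ℂ) := by
    rintro _ ⟨x, hx, rfl⟩
    exact Module.End.mem_eigenspace_iff.2 (sub_eq_zero.1 hx)
  have f1 : FiniteDimensional ℂ (LinearMap.range T) := Submodule.finiteDimensional_of_le hTr
  have f2 : FiniteDimensional ℂ ((LinearMap.ker T).map (Submodule.subtype _)) :=
    Submodule.finiteDimensional_of_le hTk
  have f3 : FiniteDimensional ℂ (LinearMap.ker T) :=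
    ((LinearMap.ker T).equivMapOfInjective _
      (Submodule.injective_subtype _)).symm.finiteDimensional
  have f4 : FiniteDimensional ℂ (_ ⧸ LinearMap.ker T) :=
    T.quotKerEquivRange.symm.finiteDimensional
  exact Module.Finite.of_submodule_quotient (LinearMap.ker T)

/-- If `(R - r)₊` has infinite rank, then some `ρ ≥ r` is an essential spectral value. -/
theorem exists_essential_value {R : H →L[ℂ] H} (hR : IsSelfAdjoint R) {r : ℝ}
    (hinf : ¬ FiniteDimensional ℂ (LinearMap.range (excess R r).toLinearMap)) :
    ∃ ρ, r ≤ ρ ∧ ¬ ((∀ᶠ x in 𝓝[≠] ρ, x ∉ spectrum ℝ R) ∧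
      FiniteDimensional ℂ (Module.End.eigenspace R.toLinearMap (ρ : ℂ))) := by
  -- The supremum of the levels of infinite rank is the required value: were it isolated with finite
  -- multiplicity, the rank would remain finite slightly below it.
  set S : Set ℝ := {s | ¬ FiniteDimensional ℂ (LinearMap.range (excess R s).toLinearMap)} with hS
  have hbdd : BddAbove S := by
    refine ⟨‖R‖, fun s hs => ?_⟩
    by_contra! hlt
    refine hs ?_
    rw [excess_eq_zero_of_norm_le hlt.le, ContinuousLinearMap.toLinearMap_zero]
    refine Submodule.finiteDimensional_of_le (S₂ := ⊥) ?_
    rintro _ ⟨x, rfl⟩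
    simp
  have hrS : r ∈ S := hinf
  refine ⟨sSup S, le_csSup hbdd hrS, ?_⟩
  rintro ⟨hiso, heig⟩
  rw [eventually_nhdsWithin_iff, Metric.eventually_nhds_iff] at hiso
  obtain ⟨ε, hε, hiso⟩ := hiso
  have hfin : FiniteDimensional ℂ (LinearMap.range (excess R (sSup S + ε / 2)).toLinearMap) := by
    by_contra h
    have := le_csSup hbdd (show sSup S + ε / 2 ∈ S from h)
    linarith
  have h1 := finiteDimensional_range_excess_of_isolated hR (ε := ε) (by linarith : 0 < ε / 2)
    (by linarith) (fun x hx hlt => by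
      by_contra hne
      exact hiso (by rwa [Real.dist_eq]) hne hx) heig hfin
  obtain ⟨s, hs, hlt⟩ := exists_lt_of_lt_csSup ⟨r, hrS⟩ (show sSup S - ε / 2 < sSup S by linarith)
  exact hs (Submodule.finiteDimensional_of_le (range_excess_anti R hlt))

/-! ### The real bilinear form of a self-adjoint operator -/

/-- The inverse of `(1 + A²)^(-1/4)` on the form domain. -/
def formRoot {A : H →ₗ.[ℂ] H} (hA : IsSelfAdjoint A) : formDomain A →ₗ[ℂ] H :=
  (LinearEquiv.ofInjective (invFourthRoot A).toLinearMap
    (invFourthRoot_injective hA)).symm.toLinearMap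

theorem invFourthRoot_formRoot {A : H →ₗ.[ℂ] H} (hA : IsSelfAdjoint A) (x : formDomain A) :
    invFourthRoot A (formRoot hA x) = x :=
  congrArg Subtype.val ((LinearEquiv.ofInjective (invFourthRoot A).toLinearMap
    (invFourthRoot_injective hA)).apply_symm_apply x)

/-- The bounded operator `A (1 + A²)^(-1/2)`. -/
def boundedTransform {A : H →ₗ.[ℂ] H} (hA : IsSelfAdjoint A) : H →L[ℂ] H :=
  (exists_boundedTransform hA).choose

theorem boundedTransform_spec {A : H →ₗ.[ℂ] H} (hA : IsSelfAdjoint A) (x : H) :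
    ∃ y : A.domain, (y : H) = invSqrt A x ∧ A y = boundedTransform hA x :=
  (exists_boundedTransform hA).choose_spec.1 x

theorem commute_invSqrt_boundedTransform {A : H →ₗ.[ℂ] H} (hA : IsSelfAdjoint A) :
    Commute (invSqrt A) (boundedTransform hA) := by
  rw [invSqrt, CFC.sqrt_eq_cfc]
  exact (exists_boundedTransform hA).choose_spec.2.cfc_nnreal _

theorem commute_invFourthRoot_boundedTransform {A : H →ₗ.[ℂ] H} (hA : IsSelfAdjoint A) :
    Commute (invFourthRoot A) (boundedTransform hA) := by
  rw [invFourthRoot, CFC.sqrt_eq_cfc]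
  exact (commute_invSqrt_boundedTransform hA).cfc_nnreal _

theorem boundedTransform_symm {A : H →ₗ.[ℂ] H} (hA : IsSelfAdjoint A) (x y : H) :
    ⟪boundedTransform hA x, y⟫_ℂ = ⟪x, boundedTransform hA y⟫_ℂ := by
  refine hA.dense_domain.induction
    (P := fun y => ⟪boundedTransform hA x, y⟫_ℂ = ⟪x, boundedTransform hA y⟫_ℂ) ?_ ?_ y
  · intro z hz
    have hz' : z ∈ LinearMap.range (invSqrt A).toLinearMap := by rw [range_invSqrt hA]; exact hz
    obtain ⟨e, rfl⟩ := hz'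
    obtain ⟨v, hv, hv'⟩ := boundedTransform_spec hA x
    obtain ⟨w, hw, hw'⟩ := boundedTransform_spec hA e
    have h1 : boundedTransform hA (invSqrt A e) = invSqrt A (boundedTransform hA e) :=
      (DFunLike.congr_fun (commute_invSqrt_boundedTransform hA).eq e).symm
    change ⟪boundedTransform hA x, invSqrt A e⟫_ℂ = ⟪x, boundedTransform hA (invSqrt A e)⟫_ℂ
    rw [h1, ← invSqrt_inner A x, ← hv, ← hw, ← hv', ← hw', domain_inner_symm hA]
  · exact isClosed_eq (by fun_prop) (by fun_prop)

/-- The real part of the sesquilinear form of `A - l`, on the form domain of `A`. -/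
def shiftedForm {A : H →ₗ.[ℂ] H} (hA : IsSelfAdjoint A) (l : ℝ) :
    formDomain A →ₗ[ℝ] formDomain A →ₗ[ℝ] ℝ :=
  LinearMap.mk₂ ℝ
    (fun x y => (⟪formRoot hA x, boundedTransform hA (formRoot hA y)⟫_ℂ).re -
      l * (⟪(x : H), (y : H)⟫_ℂ).re)
    (fun x x' y => by simp only [map_add, Submodule.coe_add, inner_add_left, Complex.add_re]; ring)
    (fun c x y => by
      have h : c • x = (c : ℂ) • x := rfl
      simp only [h, map_smul, Submodule.coe_smul, inner_smul_left, Complex.conj_ofReal,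
        Complex.re_ofReal_mul, smul_eq_mul]
      ring)
    (fun x y y' => by simp only [map_add, Submodule.coe_add, inner_add_right, Complex.add_re]; ring)
    (fun c x y => by
      have h : c • y = (c : ℂ) • y := rfl
      simp only [h, map_smul, Submodule.coe_smul, inner_smul_right,
        Complex.re_ofReal_mul, smul_eq_mul]
      ring)

theorem shiftedForm_apply {A : H →ₗ.[ℂ] H} (hA : IsSelfAdjoint A) (l : ℝ) (x y : formDomain A) :
    shiftedForm hA l x y = (⟪formRoot hA x, boundedTransform hA (formRoot hA y)⟫_ℂ).re -
      l * (⟪(x : H), (y : H)⟫_ℂ).re := rfl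

theorem shiftedForm_symm {A : H →ₗ.[ℂ] H} (hA : IsSelfAdjoint A) (l : ℝ) (x y : formDomain A) :
    shiftedForm hA l x y = shiftedForm hA l y x := by
  rw [shiftedForm_apply, shiftedForm_apply, ← inner_conj_symm, Complex.conj_re,
    boundedTransform_symm, ← inner_conj_symm (x : H), Complex.conj_re]

theorem shiftedForm_smul {A : H →ₗ.[ℂ] H} (hA : IsSelfAdjoint A) (l : ℝ) (c : ℂ)
    (x y : formDomain A) :
    shiftedForm hA l (c • x) y = shiftedForm hA l x (starRingEnd ℂ c • y) := by
  simp only [shiftedForm_apply, map_smul, Submodule.coe_smul, inner_smul_left, inner_smul_right]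

theorem shiftedForm_self {A : H →ₗ.[ℂ] H} (hA : IsSelfAdjoint A) (l : ℝ) (x : formDomain A) :
    shiftedForm hA l x x = quadForm A x - l * ‖(x : H)‖ ^ 2 := by
  have h1 : Function.invFun (invFourthRoot A) (x : H) = formRoot hA x := by
    rw [← invFourthRoot_formRoot hA x]
    exact Function.leftInverse_invFun (invFourthRoot_injective hA) _
  have h2 : totalFun A (invSqrt A (formRoot hA x)) = boundedTransform hA (formRoot hA x) := by
    obtain ⟨y, hy, hy'⟩ := boundedTransform_spec hA (formRoot hA x)
    rw [← hy, ← hy', totalFun, dif_pos y.2]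
  rw [shiftedForm_apply, quadForm, h1, h2]
  congr 2
  exact inner_self_eq_norm_sq (𝕜 := ℂ) (x : H)

theorem shiftedForm_shift {A : H →ₗ.[ℂ] H} (hA : IsSelfAdjoint A) (l t : ℝ) (x y : formDomain A) :
    shiftedForm hA (l + t) x y = shiftedForm hA l x y - t * (⟪(x : H), (y : H)⟫_ℂ).re := by
  simp only [shiftedForm_apply]; ring

/-- One argument in D(A) turns the form into an inner product, so it is norm-continuous in the other
argument. -/
theorem shiftedForm_eq_inner {A : H →ₗ.[ℂ] H} (hA : IsSelfAdjoint A) (l : ℝ) (x : A.domain)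
    (y : formDomain A) :
    shiftedForm hA l ⟨x, domain_le_formDomain hA x.2⟩ y =
      (⟪A x - (l : ℂ) • (x : H), (y : H)⟫_ℂ).re := by
  have hx : (x : H) ∈ LinearMap.range (invSqrt A).toLinearMap := by
    rw [range_invSqrt hA]; exact x.2
  obtain ⟨e, he⟩ := hx
  replace he : invSqrt A e = x := he
  have h1 : formRoot hA ⟨x, domain_le_formDomain hA x.2⟩ = invFourthRoot A e := by
    apply invFourthRoot_injective hA
    rw [invFourthRoot_formRoot hA, ← he, ← invFourthRoot_mul_self]; rfl
  have h4 : A x = boundedTransform hA e := by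
    obtain ⟨w, hw, hw'⟩ := boundedTransform_spec hA e
    rw [← hw', Subtype.ext (he.symm.trans hw.symm)]
  have h5 : boundedTransform hA (invFourthRoot A e) = invFourthRoot A (boundedTransform hA e) :=
    (DFunLike.congr_fun (commute_invFourthRoot_boundedTransform hA).eq e).symm
  rw [shiftedForm_apply, h1, ← boundedTransform_symm, h5, invFourthRoot_inner,
    invFourthRoot_formRoot, ← h4, inner_sub_left, inner_smul_left, Complex.conj_ofReal,
    Complex.sub_re, Complex.re_ofReal_mul]

theorem shiftedForm_add_self {A : H →ₗ.[ℂ] H} (hA : IsSelfAdjoint A) (l : ℝ)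
    (x y : formDomain A) :
    shiftedForm hA l (x + y) (x + y) =
      shiftedForm hA l x x + 2 * shiftedForm hA l x y + shiftedForm hA l y y := by
  simp only [map_add, LinearMap.add_apply]
  rw [shiftedForm_symm hA l y x]
  ring

/-! ### Splittings with a gap -/

/-- The subspaces `Fp`, `Fm` obtained from a core `F` by two complementary orthogonal projections,
with the form of `A` below `l - d` on `Fm` and with min-max level at least `l + e`. -/
structure GapSplitting (A : H →ₗ.[ℂ] H) (F Fp Fm : Submodule ℂ H) (l d e : ℝ) : Prop where
  core : A.HasCore F
  plus_le : Fp ≤ formDomain A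
  minus_le : Fm ≤ formDomain A
  orth : ∀ u ∈ Fp, ∀ y ∈ Fm, ⟪u, y⟫_ℂ = 0
  decomp : ∀ x ∈ F, ∃ u ∈ Fp, ∃ v ∈ Fm, u + v = x
  lift : ∀ u ∈ Fp, ∃ v ∈ Fm, u + v ∈ F
  d_pos : 0 < d
  e_pos : 0 < e
  minus : ∀ y ∈ Fm, quadForm A y ≤ (l - d) * ‖y‖ ^ 2
  plus : ∀ u ∈ Fp, ∃ y ∈ Fm, (l + e) * ‖u + y‖ ^ 2 ≤ quadForm A (u + y)

/-- Vehicle for passing from F to D(A): every closed condition on the pair (x, Ax) extends by graph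
density. -/
theorem mem_of_hasCore {A : H →ₗ.[ℂ] H} (hA : IsSelfAdjoint A) {F : Submodule ℂ H}
    (hF : A.HasCore F) {C : Set (H × H)} (hC : IsClosed C)
    (h : ∀ x : A.domain, (x : H) ∈ F → ((x : H), A x) ∈ C) (x : A.domain) :
    ((x : H), A x) ∈ C := by
  have hcl : (A.domRestrict F).IsClosable :=
    hA.isClosed.isClosable.leIsClosable A.domRestrict_le
  have h1 := hcl.graph_closure_eq_closure_graph
  rw [hF.closure_eq] at h1
  have h2 : ((x : H), A x) ∈ (A.domRestrict F).graph.topologicalClosure := by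
    rw [h1]; exact A.mem_graph x
  refine closure_minimal ?_ hC h2
  rintro ⟨p, q⟩ hpq
  obtain ⟨y, hy1, hy2⟩ := (LinearPMap.mem_graph_iff _).1 hpq
  simp only at hy1 hy2
  have hy : (y : H) ∈ F ⊓ A.domain := y.2
  have h3 : (A.domRestrict F) y = A ⟨y, hy.2⟩ := A.domRestrict_apply rfl
  rw [← hy1, ← hy2, h3]
  exact h ⟨y, hy.2⟩ hy.1

namespace GapSplitting

variable {A : H →ₗ.[ℂ] H} {F Fp Fm : Submodule ℂ H} {l d e : ℝ}

theorem shiftedForm_minus (hA : IsSelfAdjoint A) (hG : GapSplitting A F Fp Fm l d e)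
    {y : formDomain A} (hy : (y : H) ∈ Fm) :
    shiftedForm hA l y y ≤ - (d * ‖(y : H)‖ ^ 2) := by
  rw [shiftedForm_self]
  have := hG.minus y hy
  linarith

theorem exists_minus (hA : IsSelfAdjoint A) (hG : GapSplitting A F Fp Fm l d e)
    {x : formDomain A} (hx : (x : H) ∈ Fp ⊔ Fm) :
    ∃ y : formDomain A, (y : H) ∈ Fm ∧
      e * ‖(x : H) + y‖ ^ 2 ≤ shiftedForm hA l (x + y) (x + y) := by
  obtain ⟨u, hu, v, hv, huv⟩ := Submodule.mem_sup.1 hx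
  obtain ⟨y, hy, h⟩ := hG.plus u hu
  -- The F_- component v of x is absorbed into the correction, so that x + (y - v) = u + y.
  refine ⟨⟨y - v, hG.minus_le (Fm.sub_mem hy hv)⟩, Fm.sub_mem hy hv, ?_⟩
  have h1 : (x : H) + (y - v) = u + y := by rw [← huv]; abel
  rw [shiftedForm_self]
  simp only [Submodule.coe_add, h1]
  linarith

theorem mem_sup (hG : GapSplitting A F Fp Fm l d e) {x : H} (hx : x ∈ F) : x ∈ Fp ⊔ Fm := by
  obtain ⟨u, hu, v, hv, rfl⟩ := hG.decomp x hx
  exact Submodule.add_mem_sup hu hv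

/-- For x in F and g = (A - l)x, pick y in F_- with q(x + y) ≥ e‖x + y‖². Expanding, e‖x + y‖² +
d‖y‖² ≤ Re(g, x) + 2 Re(g, y), and the left side controls ‖x‖². -/
theorem norm_le (hA : IsSelfAdjoint A) (hG : GapSplitting A F Fp Fm l d e) :
    ∃ C : ℝ, 0 ≤ C ∧ ∀ x : A.domain, ‖(x : H)‖ ≤ C * ‖A x - (l : ℂ) • (x : H)‖ := by
  have hd := hG.d_pos
  have he := hG.e_pos
  set c := min d e with hc
  have hcp : 0 < c := lt_min hd he
  refine ⟨6 / c, by positivity, fun x => ?_⟩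
  refine mem_of_hasCore hA hG.core (C := {p | ‖p.1‖ ≤ 6 / c * ‖p.2 - (l : ℂ) • p.1‖})
    (isClosed_le (by fun_prop) (by fun_prop)) ?_ x
  intro x hx
  obtain ⟨y, hy, h⟩ := hG.exists_minus hA (x := ⟨x, domain_le_formDomain hA x.2⟩) (hG.mem_sup hx)
  rw [shiftedForm_add_self, shiftedForm_eq_inner, shiftedForm_eq_inner] at h
  have h1 := hG.shiftedForm_minus hA hy
  set g := A x - (l : ℂ) • (x : H) with hg
  have h2 : (⟪g, (x : H)⟫_ℂ).re ≤ ‖g‖ * ‖(x : H)‖ := re_inner_le_norm (𝕜 := ℂ) g (x : H)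
  have h3 : (⟪g, (y : H)⟫_ℂ).re ≤ ‖g‖ * ‖(y : H)‖ := re_inner_le_norm (𝕜 := ℂ) g (y : H)
  have h4 : c * ‖(x : H) + y‖ ^ 2 ≤ e * ‖(x : H) + y‖ ^ 2 := by gcongr; exact min_le_right _ _
  have h5 : c * ‖(y : H)‖ ^ 2 ≤ d * ‖(y : H)‖ ^ 2 := by gcongr; exact min_le_left _ _
  have h6 : ‖(x : H)‖ ≤ ‖(x : H) + y‖ + ‖(y : H)‖ := by
    simpa using norm_sub_le ((x : H) + y) y
  change e * ‖(x : H) + y‖ ^ 2 ≤ _ at h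
  simp only at h
  change ‖(x : H)‖ ≤ 6 / c * ‖g‖
  set X := ‖(x : H)‖
  set Y := ‖(y : H)‖
  set N := ‖(x : H) + y‖
  set γ := ‖g‖
  have hX : 0 ≤ X := norm_nonneg _
  have hY : 0 ≤ Y := norm_nonneg _
  have hN : 0 ≤ N := norm_nonneg _
  have hγ : 0 ≤ γ := norm_nonneg _
  have h7 : c * (N ^ 2 + Y ^ 2) ≤ γ * (N + 3 * Y) := by nlinarith
  -- Uses (N + Y)² ≤ 2(N² + Y²) and 2(N + 3Y) ≤ 6(N + Y); this is the source of the constant 6/c.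
  have h8 : c * (N + Y) ^ 2 ≤ 6 * γ * (N + Y) := by
    nlinarith [mul_nonneg hcp.le (sq_nonneg (N - Y)), mul_nonneg hγ hN]
  rw [div_mul_eq_mul_div, le_div_iff₀ hcp]
  rcases (add_nonneg hN hY).eq_or_lt with h0 | h0
  · have : X = 0 := by linarith
    rw [this, zero_mul]; positivity
  · have h9 : c * (N + Y) ≤ 6 * γ := by
      by_contra! hlt
      nlinarith
    nlinarith

end GapSplitting

/-! ### Resolvents -/

/-- `R` is the bounded inverse of `A - l`. -/
structure IsResolvent (A : H →ₗ.[ℂ] H) (l : ℝ) (R : H →L[ℂ] H) : Prop where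
  selfAdjoint : IsSelfAdjoint R
  exists_eq : ∀ h : H, ∃ x : A.domain, (x : H) = R h ∧ A x - (l : ℂ) • (x : H) = h
  left_inv : ∀ x : A.domain, R (A x - (l : ℂ) • (x : H)) = x

/-- The lower bound makes the range of A - l closed. Its orthogonal complement is ker(A* - l) =
ker(A - l), which the same bound makes trivial. -/
theorem bijective_of_norm_le {A : H →ₗ.[ℂ] H} (hA : IsSelfAdjoint A) {l C : ℝ} (hC : 0 ≤ C)
    (h : ∀ x : A.domain, ‖(x : H)‖ ≤ C * ‖A x - (l : ℂ) • (x : H)‖) :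
    Function.Bijective fun x : A.domain => A x - (l : ℂ) • (x : H) := by
  let S : A.domain →ₗ[ℂ] H := A.toFun - (l : ℂ) • A.domain.subtype
  have hS : ∀ x, S x = A x - (l : ℂ) • (x : H) := fun x => rfl
  change Function.Bijective S
  refine ⟨(injective_iff_map_eq_zero _).2 fun x hx => ?_, ?_⟩
  · have := h x
    rw [← hS, hx, norm_zero, mul_zero] at this
    exact Subtype.ext (norm_le_zero_iff.1 this)
  rw [← LinearMap.range_eq_top]
  have hclosed : IsClosed (LinearMap.range S : Set H) := by
    -- A shear whose preimage of the graph of A is the graph of A - l; the second projection on that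
    -- complete set is antilipschitz, hence has closed range.
    let f : H × H → H × H := fun p => (p.1, p.2 + (l : ℂ) • p.1)
    have hΓ : IsClosed (f ⁻¹' (A.graph : Set (H × H))) :=
      IsClosed.preimage (by fun_prop) hA.isClosed
    have hmem : ∀ p : H × H, f p ∈ A.graph → ∃ x : A.domain, (x : H) = p.1 ∧ S x = p.2 := by
      intro p hp
      obtain ⟨x, hx1, hx2⟩ := (LinearPMap.mem_graph_iff _).1 hp
      refine ⟨x, hx1, ?_⟩
      rw [hS, hx2, hx1]
      exact add_sub_cancel_right _ _
    have hcomp : CompleteSpace (f ⁻¹' (A.graph : Set (H × H))) :=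
      hΓ.completeSpace_coe
    have hanti : AntilipschitzWith (max 1 C.toNNReal)
        (fun p : f ⁻¹' (A.graph : Set (H × H)) => (p : H × H).2) := by
      refine AntilipschitzWith.of_le_mul_dist fun p q => ?_
      obtain ⟨x, hx1, hx2⟩ := hmem p p.2
      obtain ⟨y, hy1, hy2⟩ := hmem q q.2
      have h1 := h (x - y)
      rw [← hS, map_sub, hx2, hy2, Submodule.coe_sub, hx1, hy1, ← dist_eq_norm,
        ← dist_eq_norm] at h1
      rw [Subtype.dist_eq, Prod.dist_eq]
      have h2 : (0 : ℝ) ≤ dist (p : H × H).2 (q : H × H).2 := dist_nonneg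
      rw [NNReal.coe_max, NNReal.coe_one, Real.coe_toNNReal C hC]
      refine max_le (h1.trans ?_) ?_
      · gcongr; exact le_max_right _ _
      · exact le_mul_of_one_le_left h2 (le_max_left _ _)
    have huc : UniformContinuous
        (fun p : f ⁻¹' (A.graph : Set (H × H)) => (p : H × H).2) :=
      uniformContinuous_snd.comp uniformContinuous_subtype_val
    have h3 := hanti.isClosed_range huc
    convert h3 using 1
    ext z
    constructor
    · rintro ⟨x, rfl⟩
      refine ⟨⟨((x : H), S x), ?_⟩, rfl⟩
      have : f ((x : H), S x) = ((x : H), A x) := by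
        simp only [f, hS]; rw [sub_add_cancel]
      rw [Set.mem_preimage, this]
      exact A.mem_graph x
    · rintro ⟨p, rfl⟩
      obtain ⟨x, -, hx⟩ := hmem p p.2
      exact ⟨x, hx⟩
  have : CompleteSpace (LinearMap.range S) := hclosed.completeSpace_coe
  rw [← Submodule.orthogonal_eq_bot_iff, Submodule.eq_bot_iff]
  intro z hz
  have h1 : ∀ x : A.domain, ⟪(l : ℂ) • z, (x : H)⟫_ℂ = ⟪z, A x⟫_ℂ := by
    intro x
    have h2 := Submodule.inner_left_of_mem_orthogonal (LinearMap.mem_range_self S x) hz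
    rw [hS, inner_sub_right, inner_smul_right, sub_eq_zero] at h2
    rw [h2, inner_smul_left, Complex.conj_ofReal]
  have hmem := LinearPMap.mem_adjoint_domain_of_exists (T := A) z ⟨_, h1⟩
  have happ := LinearPMap.adjoint_apply_eq hA.dense_domain ⟨_, hmem⟩ h1
  have hAA : LinearPMap.adjoint A = A := hA
  have hmem' : z ∈ A.domain := by rw [hAA] at hmem; exact hmem
  have h2 : A ⟨z, hmem'⟩ = LinearPMap.adjoint A ⟨_, hmem⟩ :=
    (LinearPMap.dExt_iff.1 hAA).2 (x := ⟨_, hmem⟩) (y := ⟨z, hmem'⟩) rfl |>.symm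
  have h3 := h ⟨z, hmem'⟩
  rw [h2, happ, sub_self, norm_zero, mul_zero] at h3
  exact norm_le_zero_iff.1 h3

theorem exists_isResolvent {A : H →ₗ.[ℂ] H} (hA : IsSelfAdjoint A) {l C : ℝ} (hC : 0 ≤ C)
    (h : ∀ x : A.domain, ‖(x : H)‖ ≤ C * ‖A x - (l : ℂ) • (x : H)‖) :
    ∃ R : H →L[ℂ] H, IsResolvent A l R := by
  let S : A.domain ≃ₗ[ℂ] H :=
    LinearEquiv.ofBijective (A.toFun - (l : ℂ) • A.domain.subtype) (bijective_of_norm_le hA hC h)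
  have hS : ∀ x, S x = A x - (l : ℂ) • (x : H) := fun x => rfl
  let R : H →L[ℂ] H := (A.domain.subtype ∘ₗ S.symm.toLinearMap).mkContinuous C fun z => by
    have h1 := h (S.symm z)
    rw [← hS, S.apply_symm_apply] at h1
    exact h1
  have hR : ∀ z, R z = S.symm z := fun z => rfl
  refine ⟨R, ?_, fun z => ⟨S.symm z, rfl, S.apply_symm_apply z⟩, fun x => ?_⟩
  · rw [ContinuousLinearMap.isSelfAdjoint_iff_isSymmetric]
    intro z w
    change ⟪R z, w⟫_ℂ = ⟪z, R w⟫_ℂ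
    obtain ⟨x, rfl⟩ := S.surjective z
    obtain ⟨y, rfl⟩ := S.surjective w
    rw [hR, hR, S.symm_apply_apply, S.symm_apply_apply, hS, hS, inner_sub_left, inner_sub_right,
      domain_inner_symm hA, inner_smul_left, inner_smul_right, Complex.conj_ofReal]
  · rw [hR, ← hS, S.symm_apply_apply]

theorem exists_sum_norm_repr_le {E ι : Type*} [NormedAddCommGroup E] [NormedSpace ℂ E]
    [FiniteDimensional ℂ E] [Fintype ι] (b : Module.Basis ι ℂ E) :
    ∃ C : ℝ, 0 < C ∧ ∀ x : E, ∑ i, ‖b.repr x i‖ ≤ C * ‖x‖ := by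
  refine ⟨∑ i, ‖LinearMap.toContinuousLinearMap (b.coord i)‖ + 1, by positivity, fun x => ?_⟩
  have h : ∑ i, ‖b.repr x i‖ ≤ (∑ i, ‖LinearMap.toContinuousLinearMap (b.coord i)‖) * ‖x‖ := by
    rw [Finset.sum_mul]
    exact Finset.sum_le_sum fun i _ => (LinearMap.toContinuousLinearMap (b.coord i)).le_opNorm x
  linarith [norm_nonneg x]

theorem norm_sub_le_of_basis {E ι : Type*} [NormedAddCommGroup E] [NormedSpace ℂ E]
    {W : Submodule ℂ E} [Fintype ι] (b : Module.Basis ι ℂ W) (g : W →ₗ[ℂ] E) {η C : ℝ}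
    (hη : 0 ≤ η) (hC : ∀ x : W, ∑ i, ‖b.repr x i‖ ≤ C * ‖x‖)
    (hg : ∀ i, ‖g (b i) - b i‖ ≤ η) (w : W) : ‖g w - w‖ ≤ η * (C * ‖w‖) := by
  have h1 : g w - w = ∑ i, b.repr w i • (g (b i) - b i) := by
    simp only [smul_sub, Finset.sum_sub_distrib, ← map_smul, ← map_sum, ← Submodule.coe_smul,
      ← Submodule.coe_sum, b.sum_repr]
  rw [h1]
  calc ‖∑ i, b.repr w i • (g (b i) - b i)‖ ≤ ∑ i, ‖b.repr w i‖ * η :=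
        norm_sum_le_of_le _ fun i _ => by
          rw [norm_smul]; gcongr; exact hg i
    _ = η * ∑ i, ‖b.repr w i‖ := by rw [← Finset.sum_mul, mul_comm]
    _ ≤ _ := by gcongr; exact hC w

theorem shiftedForm_smul_self {A : H →ₗ.[ℂ] H} (hA : IsSelfAdjoint A) (l : ℝ) (c : ℂ)
    (x : formDomain A) :
    shiftedForm hA l (c • x) (c • x) = ‖c‖ ^ 2 * shiftedForm hA l x x := by
  have h : starRingEnd ℂ c • c • x = (‖c‖ ^ 2 : ℝ) • x := by
    rw [smul_smul, ← Complex.normSq_eq_conj_mul_self, Complex.normSq_eq_norm_sq]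
    rfl
  rw [shiftedForm_smul, h, map_smul, smul_eq_mul]

namespace IsResolvent

variable {A : H →ₗ.[ℂ] H} {l : ℝ} {R : H →L[ℂ] H}

theorem injective (hR : IsResolvent A l R) : Function.Injective R := by
  refine (injective_iff_map_eq_zero _).2 fun h hh => ?_
  obtain ⟨x, hx, hx'⟩ := hR.exists_eq h
  have : x = 0 := Subtype.ext (hx.trans hh)
  rw [← hx', this, A.map_zero]
  simp

end IsResolvent

/-! ### Near-maximisers, trial subspaces and the two rank comparisons -/

namespace GapSplitting

variable {A : H →ₗ.[ℂ] H} {F Fp Fm : Submodule ℂ H} {l d e : ℝ}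

theorem shiftedForm_minus_add (hA : IsSelfAdjoint A) (hG : GapSplitting A F Fp Fm l d e) {t : ℝ}
    (ht : 0 ≤ t) {y : formDomain A} (hy : (y : H) ∈ Fm) :
    shiftedForm hA (l + t) y y ≤ - (d * ‖(y : H)‖ ^ 2) := by
  have h1 := hG.minus y hy
  rw [shiftedForm_self]
  nlinarith [mul_nonneg ht (sq_nonneg ‖(y : H)‖)]

/-- Approximate maximisers of the form of `A - (l + t)` on `u + Fm`. -/
theorem exists_approx_maximizer (hA : IsSelfAdjoint A) (hG : GapSplitting A F Fp Fm l d e) {t : ℝ}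
    (ht : 0 ≤ t) {u : formDomain A} (hu : (u : H) ∈ Fp) {ε : ℝ} (hε : 0 < ε) :
    ∃ y : formDomain A, (y : H) ∈ Fm ∧ ∀ y' : formDomain A, (y' : H) ∈ Fm →
      (shiftedForm hA (l + t) (u + y) y') ^ 2 ≤ ε ^ 2 * (- shiftedForm hA (l + t) y' y') := by
  have hd := hG.d_pos
  obtain ⟨v, hv, hx⟩ := hG.lift u hu
  set b := shiftedForm hA (l + t) with hb
  let S : Set ℝ := {s | ∃ y : formDomain A, (y : H) ∈ Fm ∧ s = b (u + y) (u + y)}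
  have hxd : (u : H) + v ∈ A.domain := hG.core.le_domain hx
  let x : formDomain A := ⟨u + v, domain_le_formDomain hA hxd⟩
  set g := A ⟨u + v, hxd⟩ - ((l + t : ℝ) : ℂ) • ((u : H) + v) with hg
  -- Recentring at x = u + v in F makes the cross term Re(g, y''), which the bound -d‖y''‖²
  -- dominates.
  have hS : BddAbove S := by
    refine ⟨b x x + ‖g‖ ^ 2 / d, ?_⟩
    rintro _ ⟨y, hy, rfl⟩
    let y'' : formDomain A := ⟨y - v, hG.minus_le (Fm.sub_mem hy hv)⟩
    have h1 : u + y = x + y'' := Subtype.ext (by simp [x, y''])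
    have h2 := hG.shiftedForm_minus_add hA ht (y := y'') (Fm.sub_mem hy hv)
    have h3 : b x y'' = (⟪g, (y'' : H)⟫_ℂ).re := shiftedForm_eq_inner hA (l + t) ⟨u + v, hxd⟩ y''
    have h4 : (⟪g, (y'' : H)⟫_ℂ).re ≤ ‖g‖ * ‖(y'' : H)‖ := re_inner_le_norm (𝕜 := ℂ) _ _
    rw [h1, hb, shiftedForm_add_self, ← hb, h3]
    have h5 : 2 * (‖g‖ * ‖(y'' : H)‖) ≤ ‖g‖ ^ 2 / d + d * ‖(y'' : H)‖ ^ 2 := by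
      have h6 : ‖g‖ ^ 2 / d + d * ‖(y'' : H)‖ ^ 2 - 2 * (‖g‖ * ‖(y'' : H)‖) =
          (‖g‖ - d * ‖(y'' : H)‖) ^ 2 / d := by field_simp; ring
      have h7 : 0 ≤ (‖g‖ - d * ‖(y'' : H)‖) ^ 2 / d := by positivity
      linarith
    rw [← hb] at h2
    linarith
  obtain ⟨_, ⟨y, hy, rfl⟩, hlt⟩ := exists_lt_of_lt_csSup
    (⟨_, 0, Fm.zero_mem, rfl⟩ : S.Nonempty) (show sSup S - ε ^ 2 < sSup S by nlinarith)
  refine ⟨y, hy, fun y' hy' => ?_⟩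
  -- Moving from y to y + τy' raises the form by at most ε², so this quadratic in τ is nonnegative;
  -- its discriminant gives the claim.
  have h1 : ∀ τ : ℝ, 0 ≤ (- b y' y') * (τ * τ) + (- (2 * b (u + y) y')) * τ + ε ^ 2 := by
    intro τ
    have h2 : ((y + τ • y' : formDomain A) : H) ∈ Fm :=
      Fm.add_mem hy (Fm.smul_mem (τ : ℂ) hy')
    have h3 := le_csSup hS ⟨_, h2, rfl⟩
    rw [← add_assoc, hb, shiftedForm_add_self, ← hb] at h3
    simp only [map_smul, LinearMap.smul_apply, smul_eq_mul] at h3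
    nlinarith
  have h2 := discrim_le_zero h1
  rw [discrim] at h2
  linarith

/-- Approximate maximisers can be chosen linearly on a finite-dimensional subspace. -/
theorem exists_linear_approx_maximizer (hA : IsSelfAdjoint A)
    (hG : GapSplitting A F Fp Fm l d e) {t : ℝ} (ht : 0 ≤ t) {V : Submodule ℂ H} (hV : V ≤ Fp)
    [FiniteDimensional ℂ V] {ε : ℝ} (hε : 0 < ε) :
    ∃ Y : V →ₗ[ℂ] formDomain A, (∀ u, (Y u : H) ∈ Fm) ∧
      ∀ (u : V) (y' : formDomain A), (y' : H) ∈ Fm →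
        (shiftedForm hA (l + t) (⟨u, hG.plus_le (hV u.2)⟩ + Y u) y') ^ 2 ≤
          ε ^ 2 * ‖u‖ ^ 2 * (- shiftedForm hA (l + t) y' y') := by
  let b := Module.finBasis ℂ V
  obtain ⟨C, hC, hbC⟩ := exists_sum_norm_repr_le b
  set β := shiftedForm hA (l + t) with hβ
  let J : V →ₗ[ℂ] formDomain A := Submodule.inclusion (hV.trans hG.plus_le)
  have hJ : ∀ u, (J u : H) ∈ Fp := fun u => hV u.2
  have hε0 : 0 < ε / C := by positivity
  choose y hy hy' using fun i => hG.exists_approx_maximizer hA ht (hJ (b i)) hε0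
  let Y : V →ₗ[ℂ] formDomain A := b.constr ℂ y
  have hYb : ∀ i, Y (b i) = y i := fun i => b.constr_basis ℂ y i
  refine ⟨Y, fun u => ?_, fun u y' hm => ?_⟩
  · have h1 : LinearMap.range Y ≤ Fm.comap (formDomain A).subtype := by
      rw [b.constr_range, Submodule.span_le]
      rintro _ ⟨i, rfl⟩
      exact hy i
    exact h1 ⟨u, rfl⟩
  set P := - β y' y' with hP
  have hP0 : 0 ≤ P := by
    have := hG.shiftedForm_minus_add hA ht hm
    have h2 : 0 ≤ d * ‖(y' : H)‖ ^ 2 := mul_nonneg hG.d_pos.le (sq_nonneg _)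
    rw [← hβ] at this
    linarith
  have h1 : ∀ (i) (c : ℂ), |β (c • (J (b i) + y i)) y'| ≤ ‖c‖ * (ε / C * √P) := by
    intro i c
    have h2 := hy' i (starRingEnd ℂ c • y') (Fm.smul_mem _ hm)
    rw [← shiftedForm_smul, shiftedForm_smul_self, RCLike.norm_conj] at h2
    refine abs_le_of_sq_le_sq (h2.trans (le_of_eq ?_)) (by positivity)
    rw [mul_pow, mul_pow, Real.sq_sqrt hP0, hP]
    ring
  have h2 : (⟨u, hG.plus_le (hV u.2)⟩ + Y u : formDomain A) =
      ∑ i, b.repr u i • (J (b i) + y i) := by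
    change J u + Y u = _
    simp only [smul_add, Finset.sum_add_distrib, ← hYb, ← map_smul, ← map_sum, b.sum_repr]
  have h3 : |β (⟨u, hG.plus_le (hV u.2)⟩ + Y u) y'| ≤ ε * ‖u‖ * √P := by
    rw [h2, map_sum, LinearMap.sum_apply]
    calc |∑ i, β (b.repr u i • (J (b i) + y i)) y'|
        ≤ ∑ i, ‖b.repr u i‖ * (ε / C * √P) :=
          (Finset.abs_sum_le_sum_abs _ _).trans (Finset.sum_le_sum fun i _ => h1 i _)
      _ = (∑ i, ‖b.repr u i‖) * (ε / C * √P) := by rw [Finset.sum_mul]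
      _ ≤ (C * ‖u‖) * (ε / C * √P) := by gcongr; exact hbC u
      _ = ε * ‖u‖ * √P := by field_simp
  have h4 : (β (⟨u, hG.plus_le (hV u.2)⟩ + Y u) y') ^ 2 ≤ (ε * ‖u‖ * √P) ^ 2 :=
    sq_le_sq.2 (h3.trans (le_abs_self _))
  rw [mul_pow, mul_pow, Real.sq_sqrt hP0] at h4
  exact h4

/-- The case of interest is x = Rh, but the comparison vector y below exists only for x in F. The
term in ‖(A - l)x - h‖² removes y from the estimate, leaving an inequality closed in (x, Ax). -/
theorem two_mul_re_inner_le (hA : IsSelfAdjoint A) (hG : GapSplitting A F Fp Fm l d e) {t : ℝ}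
    (ht : 0 < t) {h : formDomain A} (hh : (h : H) ∈ Fp ⊔ Fm) {δ : ℝ} (hδ : 0 ≤ δ)
    (happ : ∀ y' : formDomain A, (y' : H) ∈ Fm →
      (shiftedForm hA (l + t) h y') ^ 2 ≤ δ * (- shiftedForm hA (l + t) y' y'))
    (x : A.domain) :
    2 * t * (⟪A x - (l : ℂ) • (x : H), (h : H)⟫_ℂ).re ≤
      t ^ 2 * (⟪A x - (l : ℂ) • (x : H), (x : H)⟫_ℂ).re + shiftedForm hA l h h +
        2 * t ^ 2 * ‖A x - (l : ℂ) • (x : H) - h‖ ^ 2 / d + 2 * (δ * (1 + t / d)) := by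
  have hd := hG.d_pos
  refine mem_of_hasCore hA hG.core (C := {p : H × H |
    2 * t * (⟪p.2 - (l : ℂ) • p.1, (h : H)⟫_ℂ).re ≤
      t ^ 2 * (⟪p.2 - (l : ℂ) • p.1, p.1⟫_ℂ).re + shiftedForm hA l h h +
        2 * t ^ 2 * ‖p.2 - (l : ℂ) • p.1 - h‖ ^ 2 / d + 2 * (δ * (1 + t / d))})
    (isClosed_le (by fun_prop) (by fun_prop)) ?_ x
  intro x hx
  let x' : formDomain A := ⟨x, domain_le_formDomain hA x.2⟩
  set b := shiftedForm hA l with hb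
  have hmem : ((t • x' - h : formDomain A) : H) ∈ Fp ⊔ Fm :=
    Submodule.sub_mem _ (Submodule.smul_mem _ (t : ℂ) (hG.mem_sup hx)) hh
  -- In the expansion of q(tx - h + y) the terms linear in y are 2t Re(g - h, y) - 2s, where s is
  -- the form of A - l - t at (h, y). Each part costs half of -q(y), plus an error independent of y.
  obtain ⟨y, hy, h1⟩ := hG.exists_minus hA hmem
  have h1' : 0 ≤ b (t • x' - h + y) (t • x' - h + y) := le_trans (by have := hG.e_pos; positivity) h1
  have hbx : ∀ z : formDomain A, b x' z = (⟪A x - (l : ℂ) • (x : H), (z : H)⟫_ℂ).re :=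
    fun z => shiftedForm_eq_inner hA l x z
  have hbhx : b h x' = b x' h := shiftedForm_symm hA l _ _
  have h2 := happ y hy
  rw [shiftedForm_shift, shiftedForm_shift, ← hb] at h2
  have hyy : (⟪(y : H), (y : H)⟫_ℂ).re = ‖(y : H)‖ ^ 2 := inner_self_eq_norm_sq (𝕜 := ℂ) _
  rw [hyy] at h2
  have h3 := hG.shiftedForm_minus hA hy
  rw [← hb] at h3
  rw [hb, shiftedForm_add_self, ← hb] at h1'
  simp only [map_sub, LinearMap.sub_apply, map_smul, LinearMap.smul_apply, smul_eq_mul, hbhx] at h1'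
  rw [hbx y, hbx h, hbx x'] at h1'
  change 2 * t * (⟪A x - (l : ℂ) • (x : H), (h : H)⟫_ℂ).re ≤
      t ^ 2 * (⟪A x - (l : ℂ) • (x : H), (x : H)⟫_ℂ).re + b h h +
        2 * t ^ 2 * ‖A x - (l : ℂ) • (x : H) - h‖ ^ 2 / d + 2 * (δ * (1 + t / d))
  set g := A x - (l : ℂ) • (x : H) with hg
  have h4 : (⟪g, (y : H)⟫_ℂ).re - (⟪(h : H), (y : H)⟫_ℂ).re ≤ ‖g - h‖ * ‖(y : H)‖ := by
    rw [← Complex.sub_re, ← inner_sub_left]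
    exact re_inner_le_norm (𝕜 := ℂ) _ _
  set s := b h y - t * (⟪(h : H), (y : H)⟫_ℂ).re with hs
  set P := - b y y with hP
  set N := ‖(y : H)‖ with hN
  set η := ‖g - (h : H)‖ with hη
  have hη0 : 0 ≤ η := norm_nonneg _
  have hN0 : 0 ≤ N := norm_nonneg _
  have hPN : d * N ^ 2 ≤ P := by linarith
  have hP0 : 0 ≤ P := le_trans (by positivity) hPN
  have h5 : s ^ 2 ≤ (δ * (1 + t / d)) * P := by
    have h6 : t * N ^ 2 ≤ t / d * P := by
      rw [div_mul_eq_mul_div, le_div_iff₀ hd]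
      nlinarith
    calc s ^ 2 ≤ δ * (- (b y y - t * N ^ 2)) := h2
      _ = δ * (P + t * N ^ 2) := by rw [hP]; ring
      _ ≤ δ * (P + t / d * P) := by gcongr
      _ = _ := by ring
  set E := δ * (1 + t / d) with hE
  have hE0 : 0 ≤ E := by positivity
  have h7 : -(2 * s) ≤ 2 * E + P / 2 := by
    refine (abs_le_of_sq_le_sq' ?_ (by positivity)).2
    nlinarith [sq_nonneg (2 * E - P / 2)]
  have h8 : 2 * t * (η * N) ≤ 2 * t ^ 2 * η ^ 2 / d + P / 2 := by
    have h9 : 2 * t ^ 2 * η ^ 2 / d + d * N ^ 2 / 2 - 2 * t * (η * N) =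
        (2 * t * η - d * N) ^ 2 / (2 * d) := by field_simp; ring
    have h10 : 0 ≤ (2 * t * η - d * N) ^ 2 / (2 * d) := by positivity
    linarith
  have h11 := mul_le_mul_of_nonneg_left h4 (by linarith : 0 ≤ 2 * t)
  simp only [x'] at h1'
  nlinarith

/-- A subspace of `Fp` on which the min-max level is at most `l + t` gives a lower bound for the
dimension of the spectral subspace of `A` for `(l, l + 1 / r)` whenever `r < 1 / t`. -/
theorem rank_le (hA : IsSelfAdjoint A) (hG : GapSplitting A F Fp Fm l d e) {R : H →L[ℂ] H}
    (hR : IsResolvent A l R) {t r : ℝ} (ht : 0 < t) (hrt : r * t < 1)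
    {V : Submodule ℂ H} (hV : V ≤ Fp) [FiniteDimensional ℂ V]
    (hneg : ∀ x ∈ V ⊔ Fm, quadForm A x ≤ (l + t) * ‖x‖ ^ 2) :
    Module.rank ℂ V ≤ Module.rank ℂ (LinearMap.range (excess R r).toLinearMap) := by
  have hd := hG.d_pos
  -- Makes the total error at most half of the available margin t(1 - rt)‖Tu‖².
  set ε := √(t * (1 - r * t) / 2 / (2 * (1 + t / d))) with hε
  have hnn : 0 < t * (1 - r * t) / 2 / (2 * (1 + t / d)) := by
    have : 0 < 1 - r * t := by linarith
    positivity
  have hε0 : 0 < ε := Real.sqrt_pos.2 hnn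
  have hε2 : 2 * (ε ^ 2 * (1 + t / d)) = t * (1 - r * t) / 2 := by
    rw [hε, Real.sq_sqrt hnn.le]
    have : 1 + t / d ≠ 0 := by positivity
    field_simp
  obtain ⟨Y, hY, happ⟩ := hG.exists_linear_approx_maximizer hA ht.le hV hε0
  let J : V →ₗ[ℂ] formDomain A := Submodule.inclusion (hV.trans hG.plus_le)
  have hJ : ∀ u, (J u : H) = u := fun u => rfl
  let T : V →ₗ[ℂ] H := (formDomain A).subtype ∘ₗ (J + Y)
  have hT : ∀ u, T u = u + Y u := fun u => rfl
  have hnorm : ∀ u : V, ‖u‖ ^ 2 ≤ ‖T u‖ ^ 2 := by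
    intro u
    have h1 : ‖(u : H) + Y u‖ ^ 2 = ‖(u : H)‖ ^ 2 + ‖(Y u : H)‖ ^ 2 := by
      have h2 := norm_add_sq (𝕜 := ℂ) (u : H) (Y u)
      rw [hG.orth u (hV u.2) (Y u) (hY u)] at h2
      simpa using h2
    rw [hT, h1, Submodule.coe_norm]
    linarith [sq_nonneg ‖(Y u : H)‖]
  have hkey : ∀ u : V, u ≠ 0 → r * ‖T u‖ ^ 2 < (⟪T u, R (T u)⟫_ℂ).re := by
    intro u hu
    have hpos : 0 < ‖T u‖ ^ 2 := lt_of_lt_of_le (by positivity) (hnorm u)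
    have hsup : T u ∈ V ⊔ Fm := Submodule.add_mem_sup u.2 (hY u)
    obtain ⟨x, hx, hx'⟩ := hR.exists_eq (T u)
    have h1 := hG.two_mul_re_inner_le hA ht (h := J u + Y u) (δ := ε ^ 2 * ‖u‖ ^ 2)
      (Submodule.add_mem_sup (hV u.2) (hY u)) (by positivity) (happ u) x
    have h2 : ((J u + Y u : formDomain A) : H) = T u := rfl
    rw [h2, hx', sub_self, norm_zero, shiftedForm_self, h2, hx] at h1
    have h3 := hneg _ hsup
    have h4 : (⟪T u, T u⟫_ℂ).re = ‖T u‖ ^ 2 := inner_self_eq_norm_sq (𝕜 := ℂ) _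
    rw [h4] at h1
    have h5 : 2 * (ε ^ 2 * ‖u‖ ^ 2 * (1 + t / d)) ≤ t * (1 - r * t) / 2 * ‖T u‖ ^ 2 := by
      rw [← hε2]
      have h6 : 0 ≤ 2 * (ε ^ 2 * (1 + t / d)) := by positivity
      calc 2 * (ε ^ 2 * ‖u‖ ^ 2 * (1 + t / d)) = 2 * (ε ^ 2 * (1 + t / d)) * ‖u‖ ^ 2 := by ring
        _ ≤ _ := by gcongr ?_ * ?_; exact hnorm u
    have h7 : t * (t * (r * ‖T u‖ ^ 2)) < t * (t * (⟪T u, R (T u)⟫_ℂ).re) := by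
      have h8 : 0 < t * (1 - r * t) / 2 * ‖T u‖ ^ 2 := by
        have : 0 < 1 - r * t := by linarith
        positivity
      have h9 : 2 * t ^ 2 * (0 : ℝ) ^ 2 / d = 0 := by simp
      rw [h9] at h1
      nlinarith
    exact lt_of_mul_lt_mul_left (lt_of_mul_lt_mul_left h7 ht.le) ht.le
  let S : V →ₗ[ℂ] LinearMap.range (excess R r).toLinearMap :=
    (excess R r).toLinearMap.rangeRestrict ∘ₗ T
  refine LinearMap.rank_le_of_injective S ((injective_iff_map_eq_zero _).2 fun u hu => ?_)
  by_contra hne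
  have h1 : excess R r (T u) = 0 := congrArg Subtype.val hu
  exact absurd (re_inner_of_excess_eq_zero hR.selfAdjoint h1) (not_le.2 (hkey u hne))

/-- As F is a core, (A - l)F is dense in H. -/
theorem exists_core_near (hA : IsSelfAdjoint A) (hF : A.HasCore F) {R : H →L[ℂ] H}
    (hR : IsResolvent A l R) (h : H) {η : ℝ} (hη : 0 < η) :
    ∃ g, R g ∈ F ∧ ‖g - h‖ ≤ η := by
  obtain ⟨x, -, hx⟩ := hR.exists_eq h
  have h1 := mem_of_hasCore hA hF
    (C := {p : H × H | p.2 - (l : ℂ) • p.1 ∈ closure {g | R g ∈ F}})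
    (isClosed_closure.preimage (by fun_prop))
    (fun x hx => subset_closure (by rw [Set.mem_ofPred_eq, hR.left_inv]; exact hx)) x
  simp only [Set.mem_ofPred_eq, hx] at h1
  obtain ⟨g, hg, hgh⟩ := Metric.mem_closure_iff.1 h1 η hη
  exact ⟨g, hg, by rw [← dist_eq_norm, dist_comm]; exact hgh.le⟩

/-- A subspace of the spectral subspace of `A` for `(l, l + 1 / r)` gives a trial subspace of `Fp`
of the same dimension, with level at most `l + t` whenever `1 / r < t`. -/
theorem exists_trial_subspace (hA : IsSelfAdjoint A) (hG : GapSplitting A F Fp Fm l d e)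
    {R : H →L[ℂ] H} (hR : IsResolvent A l R) {t r : ℝ} (ht : 0 < t) (hrt : 1 < r * t)
    {W : Submodule ℂ H} (hW : W ≤ LinearMap.range (excess R r).toLinearMap)
    [FiniteDimensional ℂ W] :
    ∃ V ≤ Fp, Module.finrank ℂ V = Module.finrank ℂ W ∧
      ∀ z ∈ V ⊔ Fm, quadForm A z ≤ (l + t) * ‖z‖ ^ 2 := by
  let b := Module.finBasis ℂ W
  obtain ⟨C, hC, hbC⟩ := exists_sum_norm_repr_le b
  -- The bound 1/2 keeps g injective. The other one gives 1 + 3η ≤ t(r - 3η‖R‖), where 1 + 3η bounds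
  -- ‖g w‖²/‖w‖² and r - 3η‖R‖ is the perturbed lower bound for (g w, R g w).
  set η := min (1 / 2) ((r * t - 1) / (3 * (1 + t * ‖R‖))) with hη
  have hη0 : 0 < η := by
    refine lt_min (by norm_num) (div_pos (by linarith) (by positivity))
  have hη1 : η ≤ 1 / 2 := min_le_left _ _
  have hη2 : 3 * η * (1 + t * ‖R‖) ≤ r * t - 1 := by
    have h1 : η ≤ (r * t - 1) / (3 * (1 + t * ‖R‖)) := min_le_right _ _
    rw [le_div_iff₀ (by positivity)] at h1
    linarith
  choose γ hγF hγ using fun i => exists_core_near hA hG.core hR (b i : H) (η := η / C) (by positivity)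
  choose u hu v hv huv using fun i => hG.decomp _ (hγF i)
  let g : W →ₗ[ℂ] H := b.constr ℂ γ
  let U : W →ₗ[ℂ] H := b.constr ℂ u
  let M : W →ₗ[ℂ] H := b.constr ℂ v
  have hUF : ∀ w, U w ∈ Fp := by
    have : LinearMap.range U ≤ Fp := by
      rw [b.constr_range, Submodule.span_le]; rintro _ ⟨i, rfl⟩; exact hu i
    exact fun w => this ⟨w, rfl⟩
  have hMF : ∀ w, M w ∈ Fm := by
    have : LinearMap.range M ≤ Fm := by
      rw [b.constr_range, Submodule.span_le]; rintro _ ⟨i, rfl⟩; exact hv i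
    exact fun w => this ⟨w, rfl⟩
  have hRg : ∀ w, R (g w) = U w + M w := by
    have : R.toLinearMap ∘ₗ g = U + M := b.ext fun i => by
      change R (g (b i)) = U (b i) + M (b i)
      rw [b.constr_basis, b.constr_basis, b.constr_basis, huv]
    exact fun w => LinearMap.congr_fun this w
  have hgw : ∀ w : W, ‖g w - w‖ ≤ η * ‖w‖ := by
    intro w
    have := norm_sub_le_of_basis b g (by positivity : 0 ≤ η / C) hbC
      (fun i => by rw [b.constr_basis]; exact hγ i) w
    rwa [← mul_assoc, div_mul_cancel₀ _ hC.ne'] at this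
  have hg0 : ∀ w, g w = 0 → w = 0 := by
    intro w hw
    have h1 := hgw w
    rw [hw, zero_sub, norm_neg, ← Submodule.coe_norm] at h1
    by_contra hne
    have : 0 < ‖w‖ := norm_pos_iff.2 hne
    nlinarith
  have hkey : ∀ w : W, ‖g w‖ ^ 2 ≤ t * (⟪g w, R (g w)⟫_ℂ).re := by
    intro w
    obtain ⟨δ, hδ⟩ : ∃ δ, g w = w + δ := ⟨g w - w, by abel⟩
    have h1 : ‖δ‖ ≤ η * ‖(w : H)‖ := by
      have := hgw w
      rwa [hδ, add_sub_cancel_left] at this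
    have h2 := re_inner_of_mem_range_excess hR.selfAdjoint (hW w.2)
    have hs : ⟪(w : H), R δ⟫_ℂ = ⟪R w, δ⟫_ℂ := (hR.selfAdjoint.isSymmetric (w : H) δ).symm
    have h3 : (⟪g w, R (g w)⟫_ℂ).re =
        (⟪(w : H), R w⟫_ℂ).re + (⟪R w, δ⟫_ℂ).re + (⟪δ, R w⟫_ℂ).re + (⟪δ, R δ⟫_ℂ).re := by
      rw [hδ, map_add, inner_add_left, inner_add_right, inner_add_right, hs]
      simp only [Complex.add_re]
      ring
    have h4 : |(⟪R w, δ⟫_ℂ).re| ≤ ‖R‖ * ‖(w : H)‖ * ‖δ‖ :=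
      (Complex.abs_re_le_norm _).trans ((norm_inner_le_norm _ _).trans
        (by gcongr; exact R.le_opNorm _))
    have h5 : |(⟪δ, R w⟫_ℂ).re| ≤ ‖δ‖ * (‖R‖ * ‖(w : H)‖) :=
      (Complex.abs_re_le_norm _).trans ((norm_inner_le_norm _ _).trans
        (by gcongr; exact R.le_opNorm _))
    have h6 : |(⟪δ, R δ⟫_ℂ).re| ≤ ‖δ‖ * (‖R‖ * ‖δ‖) :=
      (Complex.abs_re_le_norm _).trans ((norm_inner_le_norm _ _).trans
        (by gcongr; exact R.le_opNorm _))
    have h7 : ‖g w‖ ≤ ‖(w : H)‖ + ‖δ‖ := by rw [hδ]; exact norm_add_le _ _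
    set N := ‖(w : H)‖
    set D := ‖δ‖
    set ρ := ‖R‖
    have hN : 0 ≤ N := norm_nonneg _
    have hD : 0 ≤ D := norm_nonneg _
    have hρ : 0 ≤ ρ := norm_nonneg _
    have h8 : ‖g w‖ ^ 2 ≤ (1 + 3 * η) * N ^ 2 := by
      have h9 : ‖g w‖ ≤ (1 + η) * N := by linarith
      calc ‖g w‖ ^ 2 ≤ ((1 + η) * N) ^ 2 := by gcongr
        _ = (1 + η) ^ 2 * N ^ 2 := by ring
        _ ≤ _ := by gcongr; nlinarith
    have h10 : 2 * (ρ * N * D) + D * (ρ * D) ≤ 3 * η * ρ * N ^ 2 := by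
      have h11 : ρ * N * D ≤ ρ * N * (η * N) := by gcongr
      have h12 : D * (ρ * D) ≤ (η * N) * (ρ * (η * N)) := by gcongr
      have h13 : (η * N) * (ρ * (η * N)) ≤ η * ρ * N ^ 2 := by
        have : η * η ≤ η * 1 := by gcongr; linarith
        calc (η * N) * (ρ * (η * N)) = (η * η) * (ρ * N ^ 2) := by ring
          _ ≤ (η * 1) * (ρ * N ^ 2) := by gcongr
          _ = _ := by ring
      nlinarith
    have h14 : (r - 3 * η * ρ) * N ^ 2 ≤ (⟪g w, R (g w)⟫_ℂ).re := by
      rw [h3]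
      have := neg_le_of_abs_le h4
      have := neg_le_of_abs_le h5
      have := neg_le_of_abs_le h6
      nlinarith
    have h15 : t * ((r - 3 * η * ρ) * N ^ 2) ≤ t * (⟪g w, R (g w)⟫_ℂ).re := by gcongr
    have h16 : (1 + 3 * η) * N ^ 2 ≤ (t * (r - 3 * η * ρ)) * N ^ 2 := by
      gcongr
      nlinarith
    linarith
  have hform : ∀ (w : W) (z : formDomain A), ∃ f : formDomain A, (f : H) = U w + M w ∧
      shiftedForm hA l f z = (⟪g w, (z : H)⟫_ℂ).re ∧
      shiftedForm hA l f f = (⟪g w, R (g w)⟫_ℂ).re := by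
    intro w z
    obtain ⟨x, hx, hx'⟩ := hR.exists_eq (g w)
    refine ⟨⟨x, domain_le_formDomain hA x.2⟩, hx.trans (hRg w), ?_, ?_⟩
    · rw [shiftedForm_eq_inner, hx']
    · rw [shiftedForm_eq_inner, hx', hx]
  -- If U w = 0 then R(g w) lies in F_-, where q ≤ 0, whereas q(R(g w)) ≥ ‖g w‖²/t.
  have hinj : Function.Injective U := by
    refine (injective_iff_map_eq_zero _).2 fun w hw => hg0 w ?_
    obtain ⟨f, hf, -, hff⟩ := hform w 0
    rw [hw, zero_add] at hf
    have h1 := hG.shiftedForm_minus hA (y := f) (by rw [hf]; exact hMF w)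
    have h2 : 0 ≤ d * ‖(f : H)‖ ^ 2 := mul_nonneg hG.d_pos.le (sq_nonneg _)
    have h3 := hkey w
    rw [← hff] at h3
    have h4 : ‖g w‖ ^ 2 ≤ 0 := by nlinarith
    exact norm_eq_zero.1 (pow_eq_zero_iff two_ne_zero |>.1 (le_antisymm h4 (sq_nonneg _)))
  refine ⟨LinearMap.range U, ?_, LinearMap.finrank_range_of_inj hinj, ?_⟩
  · rintro _ ⟨w, rfl⟩
    exact hUF w
  intro z hz
  obtain ⟨_, ⟨w, rfl⟩, y, hy, rfl⟩ := Submodule.mem_sup.1 hz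
  have hzF : U w + y ∈ formDomain A :=
    (formDomain A).add_mem (hG.plus_le (hUF w)) (hG.minus_le hy)
  obtain ⟨f, hf, hfz, hff⟩ := hform w ⟨U w + y, hzF⟩
  -- Rewrites z = U w + y as f + y' with f = R(g w), so that q(z) = 2 Re(g w, z) - q(f) + q(y').
  let y' : formDomain A := ⟨y - M w, hG.minus_le (Fm.sub_mem hy (hMF w))⟩
  have hzf : (⟨U w + y, hzF⟩ : formDomain A) = f + y' :=
    Subtype.ext (by simp only [y', Submodule.coe_add, hf]; abel)
  have h1 := shiftedForm_self hA l ⟨U w + y, hzF⟩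
  have h2 := hG.shiftedForm_minus hA (y := y') (Fm.sub_mem hy (hMF w))
  have h3 : 0 ≤ d * ‖(y' : H)‖ ^ 2 := mul_nonneg hG.d_pos.le (sq_nonneg _)
  rw [hzf, map_add] at hfz
  rw [hzf, shiftedForm_add_self, ← hzf] at h1
  rw [hzf.symm] at hfz
  simp only at h1 hfz
  have h4 : (⟪g w, U w + y⟫_ℂ).re ≤ ‖g w‖ * ‖U w + y‖ := re_inner_le_norm (𝕜 := ℂ) _ _
  have h5 := hkey w
  rw [← hff] at h5
  have h6 : 2 * (‖g w‖ * ‖U w + y‖) ≤ shiftedForm hA l f f + t * ‖U w + y‖ ^ 2 := by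
    refine le_of_mul_le_mul_left ?_ ht
    nlinarith [sq_nonneg (‖g w‖ - t * ‖U w + y‖)]
  linarith

end GapSplitting

/-! ### The spectrum of `A` in terms of a resolvent -/

theorem mem_eigenspace {E : Type*} [NormedAddCommGroup E] [InnerProductSpace ℂ E]
    {A : E →ₗ.[ℂ] E} {s : ℝ} {h : E} :
    h ∈ eigenspace A s ↔ ∃ x : A.domain, (x : E) = h ∧ A x = (s : ℂ) • (x : E) := by
  constructor
  · rintro ⟨x, hx, rfl⟩
    exact ⟨x, rfl, sub_eq_zero.1 hx⟩
  · rintro ⟨x, rfl, hx⟩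
    exact ⟨x, sub_eq_zero.2 hx, rfl⟩

theorem eigenspace_eq_bot {E : Type*} [NormedAddCommGroup E] [InnerProductSpace ℂ E]
    {A : E →ₗ.[ℂ] E} {s : ℝ} (hs : (s : ℂ) ∉ opSpectrum A) :
    eigenspace A s = ⊥ := by
  have hbij : Function.Bijective fun x : A.domain => A x - (s : ℂ) • (x : E) := not_not.1 hs
  rw [Submodule.eq_bot_iff]
  intro h hh
  obtain ⟨x, rfl, hx⟩ := mem_eigenspace.1 hh
  have : x = 0 := hbij.1 (by simp only [hx]; simp)
  rw [this]; rfl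

namespace IsResolvent

variable {A : H →ₗ.[ℂ] H} {l : ℝ} {R : H →L[ℂ] H}

theorem eigenspace_eq (hR : IsResolvent A l R) {s : ℝ} (hs : s ≠ l) :
    eigenspace A s = Module.End.eigenspace R.toLinearMap (((s - l)⁻¹ : ℝ) : ℂ) := by
  have hne : ((s - l : ℝ) : ℂ) ≠ 0 := Complex.ofReal_ne_zero.2 (sub_ne_zero.2 hs)
  ext h
  rw [mem_eigenspace, Module.End.mem_eigenspace_iff, Complex.ofReal_inv]
  constructor
  · rintro ⟨x, rfl, hx⟩
    have h1 := hR.left_inv x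
    rw [hx, ← sub_smul, ← Complex.ofReal_sub, map_smul] at h1
    change R (x : H) = _
    rw [eq_inv_smul_iff₀ hne, h1]
  · intro hh
    replace hh : R h = ((s - l : ℝ) : ℂ)⁻¹ • h := hh
    obtain ⟨x, hx, hx'⟩ := hR.exists_eq h
    have hhx : h = ((s - l : ℝ) : ℂ) • (x : H) := by
      rw [hx, hh, smul_inv_smul₀ hne]
    have h1 : A x = (s : ℂ) • (x : H) := by
      rw [← sub_eq_zero, ← sub_eq_zero.2 (hx'.trans hhx), Complex.ofReal_sub, sub_smul]
      abel
    refine ⟨((s - l : ℝ) : ℂ) • x, hhx.symm, ?_⟩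
    rw [A.map_smul, h1, Submodule.coe_smul, smul_comm]

theorem mem_opSpectrum_iff (hR : IsResolvent A l R) {z : ℂ} (hz : z ≠ l) :
    z ∈ opSpectrum A ↔ (z - l)⁻¹ ∈ spectrum ℂ R := by
  have hne : z - l ≠ 0 := sub_ne_zero.2 hz
  rw [spectrum.mem_iff, ContinuousLinearMap.isUnit_iff_bijective]
  refine not_congr ?_
  choose ρ hρ hρ' using hR.exists_eq
  have hρb : Function.Bijective ρ := by
    refine ⟨fun x y hxy => ?_, fun x => ⟨A x - (l : ℂ) • (x : H), ?_⟩⟩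
    · rw [← hρ' x, ← hρ' y, hxy]
    · exact Subtype.ext ((hρ _).trans (hR.left_inv x))
  have h1 : (fun x : A.domain => A x - z • (x : H)) ∘ ρ =
      fun h => (z - l) • ((algebraMap ℂ (H →L[ℂ] H) (z - l)⁻¹ - R) h) := by
    ext h
    have h2 : (algebraMap ℂ (H →L[ℂ] H) (z - l)⁻¹ - R) h = (z - l)⁻¹ • h - R h := rfl
    rw [h2, smul_sub, smul_inv_smul₀ hne, ← hρ h, Function.comp_apply,
      sub_eq_iff_eq_add.1 (hρ' h), sub_smul]
    abel
  rw [← Function.Bijective.of_comp_iff _ hρb, h1]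
  exact (MulAction.bijective₀ hne).of_comp_iff' _

theorem mem_opSpectrum_real_iff (hR : IsResolvent A l R) {s : ℝ} (hs : s ≠ l) :
    (s : ℂ) ∈ opSpectrum A ↔ (s - l)⁻¹ ∈ spectrum ℝ R := by
  rw [hR.mem_opSpectrum_iff (fun h => hs (Complex.ofReal_injective h)),
    ← spectrum.algebraMap_mem_iff ℂ (R := ℝ), Complex.coe_algebraMap, Complex.ofReal_inv,
    Complex.ofReal_sub]

/-- If the spectral subspace of `A` for `(l, m)` is infinite-dimensional, there is essential
spectrum in `(l, m]`. -/
theorem exists_mem_essentialSpectrum (hR : IsResolvent A l R) {m : ℝ} (hm : l < m)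
    (hinf : ¬ FiniteDimensional ℂ (LinearMap.range (excess R (m - l)⁻¹).toLinearMap)) :
    ∃ t ∈ essentialSpectrum A, l < t ∧ t ≤ m := by
  obtain ⟨ρ, hρ, hess⟩ := exists_essential_value hR.selfAdjoint hinf
  have hml : 0 < m - l := by linarith
  have hρ0 : 0 < ρ := lt_of_lt_of_le (inv_pos.2 hml) hρ
  have hne : l + ρ⁻¹ ≠ l := by simp [hρ0.ne']
  have hinv : (l + ρ⁻¹ - l)⁻¹ = ρ := by simp
  refine ⟨l + ρ⁻¹, ?_, by simp [hρ0], by linarith [inv_le_of_inv_le₀ hml hρ]⟩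
  by_contra hnot
  apply hess
  rw [← hinv, ← hR.eigenspace_eq hne, hinv]
  by_cases hsp : ((l + ρ⁻¹ : ℝ) : ℂ) ∈ opSpectrum A
  · obtain ⟨hacc, -, hfd⟩ := not_not.1 fun h => hnot ⟨hsp, h⟩
    refine ⟨?_, hfd⟩
    rw [accPt_iff_frequently, not_frequently] at hacc
    have hcont : ContinuousAt (fun x : ℝ => ((l + x⁻¹ : ℝ) : ℂ)) ρ :=
      Complex.continuous_ofReal.continuousAt.comp
        (continuousAt_const.add (continuousAt_inv₀ hρ0.ne'))
    have h1 := hcont.eventually hacc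
    rw [eventually_nhdsWithin_iff]
    filter_upwards [h1, eventually_ne_nhds hρ0.ne'] with x hx hx0 hxρ hxs
    refine hx ⟨fun h => hxρ ?_, ?_⟩
    · have := Complex.ofReal_injective h
      simpa using this
    · rw [hR.mem_opSpectrum_real_iff (by simp [hx0])]
      simpa using hxs
  · have hfd : FiniteDimensional ℂ (eigenspace A (l + ρ⁻¹)) := by
      rw [eigenspace_eq_bot hsp]; infer_instance
    refine ⟨?_, hfd⟩
    rw [hR.mem_opSpectrum_real_iff hne, hinv] at hsp
    exact eventually_nhdsWithin_of_eventually_nhds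
      ((spectrum.isClosed (𝕜 := ℝ) R).isOpen_compl.eventually_mem hsp)

/-- If the spectral subspace of `A` for `(l, m)` is finite-dimensional, there is no essential
spectrum in `(l, m)`. -/
theorem notMem_essentialSpectrum (hR : IsResolvent A l R) {m t : ℝ} (hlt : l < t) (htm : t < m)
    [hfin : FiniteDimensional ℂ (LinearMap.range (excess R (m - l)⁻¹).toLinearMap)] :
    t ∉ essentialSpectrum A := by
  have htl : 0 < t - l := by linarith
  have hr : (m - l)⁻¹ < (t - l)⁻¹ := inv_strictAnti₀ htl (by linarith)
  have hsurj : ∀ ρ : ℝ, (m - l)⁻¹ < ρ → ρ ∈ spectrum ℝ R →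
      Module.End.eigenspace R.toLinearMap (ρ : ℂ) ≠ ⊥ := by
    intro ρ hρ hsp hbot
    have hb := bijective_sub_of_finiteDimensional hR.selfAdjoint hρ fun h hh => by
      have : h ∈ Module.End.eigenspace R.toLinearMap (ρ : ℂ) :=
        Module.End.mem_eigenspace_iff.2 hh
      rwa [hbot, Submodule.mem_bot] at this
    rw [← spectrum.algebraMap_mem_iff ℂ, spectrum.mem_iff, IsUnit.sub_iff] at hsp
    exact hsp (ContinuousLinearMap.isUnit_iff_bijective.2 hb)
  rintro ⟨hsp, hess⟩
  refine hess ⟨?_, ?_, ?_⟩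
  · have hF := finite_eigenvalues_of_finiteDimensional hR.selfAdjoint (m - l)⁻¹
    rw [accPt_iff_frequently, not_frequently]
    have htne : (t : ℂ) ≠ l := fun h => hlt.ne' (Complex.ofReal_injective h)
    have hcont : ContinuousAt (fun z : ℂ => ((z - l)⁻¹).re) t :=
      Complex.continuous_re.continuousAt.comp
        ((continuousAt_id.sub continuousAt_const).inv₀ (sub_ne_zero.2 htne))
    have hval : (((t : ℂ) - l)⁻¹).re = (t - l)⁻¹ := by
      rw [← Complex.ofReal_sub, ← Complex.ofReal_inv, Complex.ofReal_re]
    have h1 := hcont.eventually_mem (s := Set.Ioi (m - l)⁻¹) (by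
      rw [hval]; exact Ioi_mem_nhds hr)
    have h2 := hcont.eventually_mem (s := ({ρ : ℝ | (m - l)⁻¹ < ρ ∧
        Module.End.eigenspace R.toLinearMap (ρ : ℂ) ≠ ⊥} \ {(t - l)⁻¹})ᶜ) (by
      rw [hval]; exact hF.sdiff.isClosed.isOpen_compl.mem_nhds (by simp))
    filter_upwards [h1, h2, eventually_ne_nhds htne] with z hz1 hz2 hzl
    rintro ⟨hzt, hzs⟩
    rw [hR.mem_opSpectrum_iff hzl] at hzs
    have hre := hR.selfAdjoint.mem_spectrum_eq_re hzs
    have hzs' : ((z - l)⁻¹).re ∈ spectrum ℝ R := by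
      rw [← spectrum.algebraMap_mem_iff ℂ]
      exact hre ▸ hzs
    refine hz2 ⟨⟨hz1, hsurj _ hz1 hzs'⟩, fun heq => hzt ?_⟩
    rw [Set.mem_singleton_iff] at heq
    rw [heq, Complex.ofReal_inv, inv_inj, Complex.ofReal_sub] at hre
    exact sub_left_injective hre
  · rw [hR.eigenspace_eq hlt.ne']
    exact hsurj _ hr ((hR.mem_opSpectrum_real_iff hlt.ne').1 hsp)
  · rw [hR.eigenspace_eq hlt.ne']
    exact Submodule.finiteDimensional_of_le fun h hh =>
      mem_range_excess_of_eigenvector hR.selfAdjoint hr (Module.End.mem_eigenspace_iff.1 hh)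

theorem eigenspace_le_range_excess (hR : IsResolvent A l R) {m s : ℝ} (hls : l < s)
    (hsm : s < m) : eigenspace A s ≤ LinearMap.range (excess R (m - l)⁻¹).toLinearMap := by
  rw [hR.eigenspace_eq hls.ne']
  exact fun h hh => mem_range_excess_of_eigenvector hR.selfAdjoint
    (inv_strictAnti₀ (by linarith) (by linarith)) (Module.End.mem_eigenspace_iff.1 hh)

theorem range_excess_le_iSup_eigenspace (hR : IsResolvent A l R) {m : ℝ} (hlm : l < m)
    [FiniteDimensional ℂ (LinearMap.range (excess R (m - l)⁻¹).toLinearMap)] :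
    LinearMap.range (excess R (m - l)⁻¹).toLinearMap ≤ ⨆ s ∈ Set.Ioo l m, eigenspace A s := by
  refine (range_excess_le_iSup hR.selfAdjoint _).trans (iSup₂_le fun ρ hρ => ?_)
  have hml : 0 < m - l := by linarith
  have hρ0 : 0 < ρ := lt_trans (inv_pos.2 hml) hρ
  have h1 : eigenspace A (l + ρ⁻¹) = Module.End.eigenspace R.toLinearMap (ρ : ℂ) := by
    rw [hR.eigenspace_eq (by simp [hρ0.ne'])]
    simp
  rw [← h1]
  refine le_iSup₂_of_le (l + ρ⁻¹) ⟨by simp [hρ0], ?_⟩ le_rfl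
  linarith [inv_lt_of_inv_lt₀ hml hρ]

theorem finite_eigenvalues (hR : IsResolvent A l R) (m : ℝ)
    [FiniteDimensional ℂ (LinearMap.range (excess R (m - l)⁻¹).toLinearMap)] :
    {s : ℝ | s ∈ Set.Ioo l m ∧ eigenspace A s ≠ ⊥}.Finite := by
  refine ((finite_eigenvalues_of_finiteDimensional hR.selfAdjoint (m - l)⁻¹).preimage
    (f := fun s => (s - l)⁻¹) fun x _ y _ h => sub_left_injective (inv_injective h)).subset ?_
  rintro s ⟨⟨h1, h2⟩, h3⟩
  rw [hR.eigenspace_eq h1.ne'] at h3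
  exact ⟨inv_strictAnti₀ (by linarith) (by linarith), h3⟩

end IsResolvent

/-! ### Min-max levels and spectral subspaces -/

theorem le_supRayleigh (A : H →ₗ.[ℂ] H) {W : Submodule ℂ H} {x : H} (hx : x ∈ W) (hx0 : x ≠ 0) :
    ((quadForm A x / ‖x‖ ^ 2 : ℝ) : EReal) ≤ supRayleigh A W :=
  le_iSup₂_of_le (f := fun x (_ : x ∈ {x : H | x ∈ W ∧ x ≠ 0}) =>
    ((quadForm A x / ‖x‖ ^ 2 : ℝ) : EReal)) x ⟨hx, hx0⟩ le_rfl

theorem quadForm_zero {A : H →ₗ.[ℂ] H} (hA : IsSelfAdjoint A) : quadForm A 0 = 0 := by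
  have h := shiftedForm_self hA 0 0
  simp only [map_zero] at h
  simpa using h.symm

theorem quadForm_smul {A : H →ₗ.[ℂ] H} (hA : IsSelfAdjoint A) (c : ℂ) {x : H}
    (hx : x ∈ formDomain A) : quadForm A (c • x) = ‖c‖ ^ 2 * quadForm A x := by
  have h := shiftedForm_smul_self hA 0 c ⟨x, hx⟩
  rw [shiftedForm_self, shiftedForm_self] at h
  simpa using h

theorem supRayleigh_le_iff {A : H →ₗ.[ℂ] H} (hA : IsSelfAdjoint A) {W : Submodule ℂ H} {m : ℝ} :
    supRayleigh A W ≤ m ↔ ∀ x ∈ W, quadForm A x ≤ m * ‖x‖ ^ 2 := by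
  constructor
  · intro h x hx
    by_cases hx0 : x = 0
    · simp [hx0, quadForm_zero hA]
    · have h1 := EReal.coe_le_coe_iff.1 ((le_supRayleigh A hx hx0).trans h)
      rwa [div_le_iff₀ (by positivity)] at h1
  · refine fun h => iSup₂_le fun x hx => EReal.coe_le_coe_iff.2 ?_
    have : x ≠ 0 := hx.2
    rw [div_le_iff₀ (by positivity)]
    exact h x hx.1

theorem minMaxLevel_le {A : H →ₗ.[ℂ] H} {Fp Fm V : Submodule ℂ H} {k : ℕ} (hV : V ≤ Fp)
    (hk : Module.finrank ℂ V = k) : minMaxLevel A Fp Fm k ≤ supRayleigh A (V ⊔ Fm) :=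
  iInf₂_le (f := fun V (_ : V ∈ {V : Submodule ℂ H | V ≤ Fp ∧ Module.finrank ℂ V = k}) =>
    supRayleigh A (V ⊔ Fm)) V ⟨hV, hk⟩

theorem exists_of_minMaxLevel_lt {A : H →ₗ.[ℂ] H} {Fp Fm : Submodule ℂ H} {k : ℕ} {m : EReal}
    (h : minMaxLevel A Fp Fm k < m) :
    ∃ V ≤ Fp, Module.finrank ℂ V = k ∧ supRayleigh A (V ⊔ Fm) < m := by
  simp only [minMaxLevel, iInf_lt_iff] at h
  obtain ⟨V, ⟨hV, hk⟩, hlt⟩ := h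
  exact ⟨V, hV, hk, hlt⟩

theorem exists_submodule_finrank_eq {M : Type*} [AddCommGroup M] [Module ℂ M]
    {E : Submodule ℂ M} {k : ℕ} (h : k ≤ Module.rank ℂ E) :
    ∃ W ≤ E, FiniteDimensional ℂ W ∧ Module.finrank ℂ W = k := by
  obtain ⟨f, hf⟩ := Module.le_rank_iff_exists_linearMap.1 h
  have hinj : Function.Injective (E.subtype ∘ₗ f) := E.injective_subtype.comp hf
  refine ⟨LinearMap.range (E.subtype ∘ₗ f), ?_, inferInstance, ?_⟩
  · rintro _ ⟨x, rfl⟩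
    exact (f x).2
  · rw [LinearMap.finrank_range_of_inj hinj, Module.finrank_fin_fun]

namespace GapSplitting

variable {A : H →ₗ.[ℂ] H} {F Fp Fm : Submodule ℂ H} {l d e : ℝ} {R : H →L[ℂ] H}

theorem minMaxLevel_le_of_le_rank (hA : IsSelfAdjoint A) (hG : GapSplitting A F Fp Fm l d e)
    (hR : IsResolvent A l R) {m : ℝ} (hm : l < m) {k : ℕ}
    (hk : k ≤ Module.rank ℂ (LinearMap.range (excess R (m - l)⁻¹).toLinearMap)) :
    minMaxLevel A Fp Fm k ≤ m := by
  obtain ⟨W, hW, hWfd, hWk⟩ := exists_submodule_finrank_eq hk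
  refine EReal.le_of_forall_lt_iff_le.1 fun m' hm' => ?_
  have hmm : m < m' := EReal.coe_lt_coe_iff.1 hm'
  have hml : 0 < m - l := by linarith
  obtain ⟨V, hV, hVk, hVm⟩ := hG.exists_trial_subspace hA hR (t := m' - l) (by linarith)
    (by rw [inv_mul_eq_div, one_lt_div hml]; linarith) hW
  refine (minMaxLevel_le hV (hVk.trans hWk)).trans ((supRayleigh_le_iff hA).2 ?_)
  rwa [add_sub_cancel] at hVm

theorem le_rank_of_minMaxLevel_lt (hA : IsSelfAdjoint A) (hG : GapSplitting A F Fp Fm l d e)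
    (hR : IsResolvent A l R) {m : ℝ} (hm : l < m) {k : ℕ} (hk1 : 1 ≤ k)
    (hk : minMaxLevel A Fp Fm k < m) :
    k ≤ Module.rank ℂ (LinearMap.range (excess R (m - l)⁻¹).toLinearMap) := by
  obtain ⟨V, hV, hVk, hVm⟩ := exists_of_minMaxLevel_lt hk
  have hVfd : FiniteDimensional ℂ V := Module.finite_of_finrank_pos (by omega)
  obtain ⟨m', hm1, hm2⟩ := EReal.lt_iff_exists_real_btwn.1
    (max_lt hVm (EReal.coe_lt_coe_iff.2 hm))
  obtain ⟨hm1, hlm'⟩ := max_lt_iff.1 hm1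
  have hlm : l < m' := EReal.coe_lt_coe_iff.1 hlm'
  have hmm : m' < m := EReal.coe_lt_coe_iff.1 hm2
  have h1 := hG.rank_le hA hR (t := m' - l) (r := (m - l)⁻¹) (by linarith)
    (by rw [inv_mul_eq_div, div_lt_one (by linarith)]; linarith) hV (by
      rw [add_sub_cancel]; exact (supRayleigh_le_iff hA).1 hm1.le)
  rw [← hVk, Module.finrank_eq_rank]
  exact h1

end GapSplitting

/-- The hypotheses of the min-max theorem give a gap splitting at every real `l` between the
supremum on `Fm` and the first level. -/
theorem exists_gapSplitting {A : H →ₗ.[ℂ] H} (hA : IsSelfAdjoint A) {Hp Hm : Submodule ℂ H}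
    [Hp.HasOrthogonalProjection] [Hm.HasOrthogonalProjection] (hperp : Hp ⟂ Hm)
    (hsum : Hp ⊔ Hm = ⊤) {F : Submodule ℂ H} (hF : A.HasCore F)
    (hip : F.map Hp.starProjection.toLinearMap ≤ formDomain A)
    (him : F.map Hm.starProjection.toLinearMap ≤ formDomain A) {l : ℝ}
    (hl : supRayleigh A (F.map Hm.starProjection.toLinearMap) < l)
    (hl' : l < minMaxLevel A (F.map Hp.starProjection.toLinearMap)
      (F.map Hm.starProjection.toLinearMap) 1) :
    ∃ d e, GapSplitting A F (F.map Hp.starProjection.toLinearMap)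
      (F.map Hm.starProjection.toLinearMap) l d e := by
  obtain ⟨a', ha', hal⟩ := EReal.lt_iff_exists_real_btwn.1 hl
  obtain ⟨c, hlc, hc⟩ := EReal.lt_iff_exists_real_btwn.1 hl'
  have hal : a' < l := EReal.coe_lt_coe_iff.1 hal
  have hlc : l < c := EReal.coe_lt_coe_iff.1 hlc
  have hadd : ∀ x, Hp.starProjection x + Hm.starProjection x = x := by
    intro x
    obtain ⟨p, hp, m, hm, rfl⟩ := Submodule.mem_sup.1 (hsum ▸ Submodule.mem_top : x ∈ Hp ⊔ Hm)
    rw [map_add, map_add, Submodule.starProjection_eq_self_iff.2 hp,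
      Submodule.starProjection_eq_self_iff.2 hm,
      (Submodule.starProjection_apply_eq_zero_iff Hp).2 (hperp.symm hm),
      (Submodule.starProjection_apply_eq_zero_iff Hm).2 (hperp hp)]
    abel
  have hminus := (supRayleigh_le_iff hA).1 ha'.le
  refine ⟨l - a', c - l, hF, hip, him, ?_, ?_, ?_, by linarith, by linarith, ?_, ?_⟩
  · rintro _ ⟨x, -, rfl⟩ _ ⟨y, -, rfl⟩
    exact hperp.inner_eq (Submodule.starProjection_apply_mem _ _)
      (Submodule.starProjection_apply_mem _ _)
  · exact fun x hx => ⟨_, ⟨x, hx, rfl⟩, _, ⟨x, hx, rfl⟩, hadd x⟩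
  · rintro _ ⟨x, hx, rfl⟩
    refine ⟨_, ⟨x, hx, rfl⟩, ?_⟩
    change Hp.starProjection x + Hm.starProjection x ∈ F
    rwa [hadd]
  · intro y hy
    rw [sub_sub_cancel]
    exact hminus y hy
  · intro u hu
    by_cases hu0 : u = 0
    · exact ⟨0, Submodule.zero_mem _, by simp [hu0, quadForm_zero hA]⟩
    have h1 := hc.trans_le (minMaxLevel_le (Fm := F.map Hm.starProjection.toLinearMap)
      ((Submodule.span_singleton_le_iff_mem u _).2 hu) (finrank_span_singleton (K := ℂ) hu0))
    rw [← not_le, supRayleigh_le_iff hA] at h1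
    push Not at h1
    obtain ⟨x, hx, hlt⟩ := h1
    obtain ⟨_, hz, y, hy, rfl⟩ := Submodule.mem_sup.1 hx
    obtain ⟨α, rfl⟩ := Submodule.mem_span_singleton.1 hz
    have hα : α ≠ 0 := by
      rintro rfl
      rw [zero_smul, zero_add] at hlt
      have := hminus y hy
      nlinarith [sq_nonneg ‖y‖]
    refine ⟨α⁻¹ • y, Submodule.smul_mem _ _ hy, ?_⟩
    have h2 : u + α⁻¹ • y = α⁻¹ • (α • u + y) := by rw [smul_add, inv_smul_smul₀ hα]
    have h3 : α • u + y ∈ formDomain A :=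
      Submodule.add_mem _ (Submodule.smul_mem _ _ (hip hu)) (him hy)
    rw [h2, quadForm_smul hA _ h3, norm_smul, mul_pow, add_sub_cancel]
    have h4 := mul_le_mul_of_nonneg_left hlt.le (sq_nonneg ‖α⁻¹‖)
    linarith

theorem GapSplitting.exists_resolvent {A : H →ₗ.[ℂ] H} (hA : IsSelfAdjoint A)
    {F Fp Fm : Submodule ℂ H} {l d e : ℝ} (hG : GapSplitting A F Fp Fm l d e) :
    (l : ℂ) ∉ opSpectrum A ∧ ∃ R, IsResolvent A l R := by
  obtain ⟨C, hC, h⟩ := hG.norm_le hA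
  exact ⟨not_not.2 (bijective_of_norm_le hA hC h), exists_isResolvent hA hC h⟩

/-- The comparison between the min-max levels and the ranks of the spectral subspaces implies the
min-max theorem. -/
theorem isKthLevel_of_rank {A : H →ₗ.[ℂ] H} {l : ℝ} {R : H →L[ℂ] H} (hR : IsResolvent A l R)
    {a b : EReal} (hal : a < l) (hb : b = essentialBottomAbove A a)
    (habs : ∀ s : ℝ, a < s → s ≤ l → (s : ℂ) ∉ opSpectrum A) (c : ℕ → EReal) (hc1 : l < c 1)
    (hU : ∀ m : ℝ, l < m → ∀ k : ℕ,
      k ≤ Module.rank ℂ (LinearMap.range (excess R (m - l)⁻¹).toLinearMap) → c k ≤ m)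
    (hL : ∀ m : ℝ, l < m → ∀ k : ℕ, 1 ≤ k → c k < m →
      k ≤ Module.rank ℂ (LinearMap.range (excess R (m - l)⁻¹).toLinearMap)) :
    (∀ k : ℕ, 1 ≤ k → IsKthLevel A a b k (c k)) ∧ a < b ∧ Tendsto c atTop (𝓝 b) ∧
      (⨆ k ∈ Set.Ici 1, c k) = b := by
  set E : ℝ → Submodule ℂ H := fun m => LinearMap.range (excess R (m - l)⁻¹).toLinearMap with hE
  have hfin : ∀ m : ℝ, l < m → m < b → FiniteDimensional ℂ (E m) := by
    intro m hm hmb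
    by_contra hinf
    obtain ⟨t, ht, hlt, htm⟩ := hR.exists_mem_essentialSpectrum hm hinf
    have h1 : b ≤ t := by
      rw [hb]
      exact sInf_le ⟨t, ht, hal.trans (EReal.coe_lt_coe_iff.2 hlt), rfl⟩
    exact absurd (hmb.trans_le h1) (not_lt.2 (EReal.coe_le_coe_iff.2 htm))
  have hess : ∀ t ∈ essentialSpectrum A, a < t → l < t := by
    intro t ht hat
    by_contra! hle
    exact habs t hat hle ht.1
  have hle_b : ∀ m : ℝ, l < m → FiniteDimensional ℂ (E m) → (m : EReal) ≤ b := by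
    intro m hm hfd
    rw [hb]
    refine le_sInf ?_
    rintro _ ⟨t, ht, hat, rfl⟩
    by_contra! hlt
    exact hR.notMem_essentialSpectrum (hess t ht hat) (EReal.coe_lt_coe_iff.1 hlt) ht
  have hlb' : (l : EReal) ≤ b := by
    rw [hb]
    refine le_sInf ?_
    rintro _ ⟨t, ht, hat, rfl⟩
    exact EReal.coe_le_coe_iff.2 (hess t ht hat).le
  have hcb : ∀ k, c k ≤ b := by
    intro k
    by_contra! hlt
    obtain ⟨m, hbm, hmc⟩ := EReal.lt_iff_exists_real_btwn.1 hlt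
    have hlm : l < m := EReal.coe_lt_coe_iff.1 (hlb'.trans_lt hbm)
    have hinf : ¬ FiniteDimensional ℂ (E m) := fun h => absurd (hle_b m hlm h) (not_le.2 hbm)
    rw [FiniteDimensional, ← Module.rank_lt_aleph0_iff, not_lt] at hinf
    exact absurd (hU m hlm k ((Cardinal.natCast_le_aleph0).trans hinf)) (not_le.2 hmc)
  have hlb : (l : EReal) < b := hc1.trans_le (hcb 1)
  have hlc : ∀ k : ℕ, 1 ≤ k → (l : EReal) < c k := by
    intro k hk
    by_contra! hle
    obtain ⟨m, hlm, hmc⟩ := EReal.lt_iff_exists_real_btwn.1 hc1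
    have hlm' : l < m := EReal.coe_lt_coe_iff.1 hlm
    have h1 := hL m hlm' k hk (hle.trans_lt hlm)
    have h2 : ((1 : ℕ) : Cardinal) ≤ k := Nat.cast_le.2 hk
    exact absurd (hU m hlm' 1 (h2.trans h1)) (not_le.2 hmc)
  have heig : ∀ s : ℝ, a < s → eigenspace A s ≠ ⊥ → l < s := by
    intro s has hne
    by_contra! hle
    exact hne (eigenspace_eq_bot (habs s has hle))
  have hsup_le : ∀ (I : Set ℝ) (m : ℝ), (∀ s ∈ I, a < (s : EReal)) →
      (∀ s ∈ I, eigenspace A s ≠ ⊥ → s < m) → ⨆ s ∈ I, eigenspace A s ≤ E m := by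
    intro I m hI hm
    refine iSup₂_le fun s hs => ?_
    by_cases hbot : eigenspace A s = ⊥
    · rw [hbot]; exact bot_le
    · exact hR.eigenspace_le_range_excess (heig s (hI s hs) hbot) (hm s hs hbot)
  refine ⟨fun k hk => ?_, hal.trans hlb, ?_, ?_⟩
  · rcases (hcb k).lt_or_eq with hlt | heq
    · left
      obtain ⟨t, ht⟩ : ∃ t : ℝ, c k = t :=
        ⟨(c k).toReal, (EReal.coe_toReal (ne_top_of_lt hlt) (ne_bot_of_gt (hlc k hk))).symm⟩
      have hlt' : l < t := EReal.coe_lt_coe_iff.1 (ht ▸ hlc k hk)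
      rw [ht] at hlt
      refine ⟨t, ⟨hal.trans (EReal.coe_lt_coe_iff.2 hlt'), hlt, ?_, ?_⟩, ht⟩
      · by_contra! hge
        have hfd := hfin t hlt' hlt
        have h1 : ∀ᶠ x in 𝓝[<] t, ∀ s ∈ {s : ℝ | s ∈ Set.Ioo l t ∧ eigenspace A s ≠ ⊥}, s < x :=
          (eventually_all_finite (hR.finite_eigenvalues t)).2 fun s hs =>
            eventually_nhdsWithin_of_eventually_nhds (lt_mem_nhds hs.1.2)
        have h2 : ∀ᶠ x in 𝓝[<] t, l < x :=
          eventually_nhdsWithin_of_eventually_nhds (lt_mem_nhds hlt')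
        obtain ⟨x, ⟨hx1, hx2⟩, hx3⟩ := ((h1.and h2).and self_mem_nhdsWithin).exists
        have h3 := hU x hx2 k (hge.trans (Submodule.rank_mono
          (hsup_le _ x (fun s hs => hs.1) fun s hs hne => hx1 s ⟨⟨heig s hs.1 hne, hs.2⟩, hne⟩)))
        rw [ht] at h3
        exact absurd hx3 (not_lt.2 (EReal.coe_le_coe_iff.1 h3))
      · obtain ⟨m, htm, hmb⟩ := EReal.lt_iff_exists_real_btwn.1 hlt
        have htm' : t < m := EReal.coe_lt_coe_iff.1 htm
        have hfd := hfin m (hlt'.trans htm') hmb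
        have h1 : ∀ᶠ x in 𝓝[>] t,
            ∀ s ∈ {s : ℝ | s ∈ Set.Ioo l m ∧ eigenspace A s ≠ ⊥}, t < s → x < s :=
          (eventually_all_finite (hR.finite_eigenvalues m)).2 fun s hs => by
            by_cases hts : t < s
            · filter_upwards [eventually_nhdsWithin_of_eventually_nhds (gt_mem_nhds hts)] with x hx _
              exact hx
            · exact Eventually.of_forall fun x h => absurd h hts
        have h2 : ∀ᶠ x in 𝓝[>] t, x < m :=
          eventually_nhdsWithin_of_eventually_nhds (gt_mem_nhds htm')
        obtain ⟨x, ⟨hx1, hx2⟩, hx3⟩ := ((h1.and h2).and self_mem_nhdsWithin).exists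
        have htx : t < x := hx3
        have hlx : l < x := hlt'.trans htx
        have hfdx := hfin x hlx ((EReal.coe_lt_coe_iff.2 hx2).trans hmb)
        have h3 := hL x hlx k hk (by rw [ht]; exact EReal.coe_lt_coe_iff.2 htx)
        refine h3.trans (Submodule.rank_mono
          ((hR.range_excess_le_iSup_eigenspace hlx).trans (iSup₂_le fun s hs => ?_)))
        by_cases hbot : eigenspace A s = ⊥
        · rw [hbot]; exact bot_le
        refine le_iSup₂_of_le (f := fun s (_ : s ∈ {s : ℝ | a < (s : EReal) ∧ s ≤ t}) =>
          eigenspace A s) s ⟨hal.trans (EReal.coe_lt_coe_iff.2 hs.1), ?_⟩ le_rfl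
        by_contra! hts
        exact absurd (hx1 s ⟨⟨hs.1, hs.2.trans hx2⟩, hbot⟩ hts) (not_lt.2 hs.2.le)
    · right
      refine ⟨?_, heq⟩
      rintro ⟨t, -, htb, -, hge⟩
      obtain ⟨m, htm, hmb⟩ := EReal.lt_iff_exists_real_btwn.1 (max_lt htb hlb)
      obtain ⟨h1, h2⟩ := max_lt_iff.1 htm
      have htm' : t < m := EReal.coe_lt_coe_iff.1 h1
      have h3 := hU m (EReal.coe_lt_coe_iff.1 h2) k (hge.trans (Submodule.rank_mono
        (hsup_le _ m (fun s hs => hs.1) fun s hs _ => hs.2.trans_lt htm')))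
      rw [heq] at h3
      exact absurd hmb (not_lt.2 h3)
  · rw [tendsto_order]
    refine ⟨fun x hx => ?_, fun x hx => Eventually.of_forall fun k => (hcb k).trans_lt hx⟩
    obtain ⟨m, hm, hmb⟩ := EReal.lt_iff_exists_real_btwn.1 (max_lt hx hlb)
    obtain ⟨hxm, hlm⟩ := max_lt_iff.1 hm
    have hlm' : l < m := EReal.coe_lt_coe_iff.1 hlm
    have hfd := hfin m hlm' hmb
    filter_upwards [eventually_gt_atTop (Module.finrank ℂ (E m))] with k hk
    refine hxm.trans_le (not_lt.1 fun hlt => ?_)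
    have h1 : (k : Cardinal) ≤ Module.rank ℂ (E m) := hL m hlm' k (by omega) hlt
    rw [← Module.finrank_eq_rank, Nat.cast_le] at h1
    omega
  · refine le_antisymm (iSup₂_le fun k _ => hcb k) (le_of_forall_lt fun x hx => ?_)
    obtain ⟨m, hm, hmb⟩ := EReal.lt_iff_exists_real_btwn.1 (max_lt hx hlb)
    obtain ⟨hxm, hlm⟩ := max_lt_iff.1 hm
    have hlm' : l < m := EReal.coe_lt_coe_iff.1 hlm
    have hfd := hfin m hlm' hmb
    refine hxm.trans_le (le_iSup₂_of_le (f := fun k (_ : k ∈ Set.Ici 1) => c k)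
      (Module.finrank ℂ (E m) + 1) (Set.mem_Ici.2 (by omega)) (not_lt.1 fun hlt => ?_))
    have h1 : ((Module.finrank ℂ (E m) + 1 : ℕ) : Cardinal) ≤ Module.rank ℂ (E m) :=
      hL m hlm' _ (by omega) hlt
    rw [← Module.finrank_eq_rank, Nat.cast_le] at h1
    omega

end

end GapMinMax

theorem mainTheorem1 {H : Type*} [NormedAddCommGroup H] [InnerProductSpace ℂ H] [CompleteSpace H]
    (A : H →ₗ.[ℂ] H) (hA : IsSelfAdjoint A)
    (Hp Hm : Submodule ℂ H) [Hp.HasOrthogonalProjection] [Hm.HasOrthogonalProjection]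
    (hperp : Hp ⟂ Hm) (hsum : Hp ⊔ Hm = ⊤)
    (F : Submodule ℂ H) (hF : A.HasCore F)
    (Fp Fm : Submodule ℂ H)
    (hFp : Fp = F.map Hp.starProjection.toLinearMap)
    (hFm : Fm = F.map Hm.starProjection.toLinearMap)
    (hip : Fp ≤ GapMinMax.formDomain A) (him : Fm ≤ GapMinMax.formDomain A)
    (a b : EReal)
    (ha : a = GapMinMax.supRayleigh A Fm) (haTop : a < ⊤)
    (hgap : a < GapMinMax.minMaxLevel A Fp Fm 1)
    (hb : b = GapMinMax.essentialBottomAbove A a) :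
    (∀ k : ℕ, 1 ≤ k → GapMinMax.IsKthLevel A a b k (GapMinMax.minMaxLevel A Fp Fm k)) ∧
      a < b ∧
      Tendsto (fun k : ℕ => GapMinMax.minMaxLevel A Fp Fm k) atTop (𝓝 b) ∧
      (⨆ k ∈ Set.Ici 1, GapMinMax.minMaxLevel A Fp Fm k) = b := by
  subst hFp hFm
  have hsplit := fun {s : ℝ} (h1 : a < s) h2 =>
    GapMinMax.exists_gapSplitting hA hperp hsum hF hip him (l := s) (ha ▸ h1) h2
  obtain ⟨l, hal, hlc⟩ := EReal.lt_iff_exists_real_btwn.1 hgap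
  obtain ⟨d, e, hG⟩ := hsplit hal hlc
  obtain ⟨-, R, hR⟩ := hG.exists_resolvent hA
  refine GapMinMax.isKthLevel_of_rank hR hal hb (fun s has hsl => ?_) _ hlc
    (fun m hm k hk => hG.minMaxLevel_le_of_le_rank hA hR hm hk)
    (fun m hm k hk1 hk => hG.le_rank_of_minMaxLevel_lt hA hR hm hk1 hk)
  obtain ⟨d', e', hG'⟩ := hsplit has ((EReal.coe_le_coe_iff.2 hsl).trans_lt hlc)
  exact (hG'.exists_resolvent hA).1
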